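/- Let $n,m\ge 0$ and consider the system, for $x\in[0,1]$, with $Z\in\mathbb R^m$, $Y\in\mathbb R^n$, $X\in\mathbb R^m$, $$Z_t=-\Sigma^+Z_x+\Lambda^{++}Z+\Lambda^{+-}Y+\Pi^+X+\int_0^x\big(F^{++}Z(y,t)+F^{+-}Y(y,t)\big)dy,$$ $$Y_t=\Sigma^-Y_x+\Lambda^{--}Y+\Lambda^{-+}Z+\Pi^-X+\int_0^x\big(F^{-+}Z(y,t)+F^{--}Y(y,t)\big)dy,$$ $$\dot X=AX+BY(0,t),\qquad Z(0,t)=CY(0,t)+DX,\qquad Y(1,t)=U,$$ with constant real matrices, $\Sigma^+=\mathrm{diag}(\sigma^+_1,\dots,\sigma^+_m)$, $0<\sigma_1^+\le\dots\le\sigma_m^+$, and $\Sigma^-=\mathrm{diag}(s_1,\dots,s_n)$, $s_1\ge\dots\ge s_n>0$. Indices $i,j$ with $s_i=s_j$ are in the same (isotachic) block. Let $\Lambda_{\rm blk}$ be the block diagonal part of $\Lambda^{--}$ (its entries with $s_i=s_j$), let $\mathcal A$ solve $\mathcal A'=\mathcal A(\Sigma^-)^{-1}\Lambda_{\rm blk}$,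 $\mathcal A(0)=I$, and put $\tilde{\mathcal A}=\mathcal A^{-1}$, $\bar\Lambda^{--}(x)=\mathcal A(x)(\Lambda^{--}-\Lambda_{\rm blk})\tilde{\mathcal A}(x)$, $\bar\Lambda^{+-}=\Lambda^{+-}\tilde{\mathcal A}$, $\bar\Lambda^{-+}=\mathcal A\Lambda^{-+}$, $\bar\Pi^-=\mathcal A\Pi^-$, $\bar F^{+-}=F^{+-}\tilde{\mathcal A}$, $\bar F^{-+}=\mathcal AF^{-+}$, $\bar F^{--}(x,y)=\mathcal A(x)F^{--}\tilde{\mathcal A}(y)$. The kernel equations for $K(x,y)\in\mathbb R^{n\times n}$, $L(x,y)\in\mathbb R^{n\times m}$ on $\mathcal T=\{0\le y\le x\le1\}$ and $\Phi(x)\in\mathbb R^{n\times m}$ on $[0,1]$ are $$\Sigma^-K_x+K_y\Sigma^-=K\bar\Lambda^{--}(y)-L\bar\Lambda^{+-}(y)-\Omega(x)K-\bar F^{--}(x,y)+\int_y^xK(x,s)\bar F^{--}(s,y)ds+\int_y^xL(x,s)\bar F^{+-}(y)ds,$$ $$\Sigma^-L_x-L_y\Sigma^+=K\bar\Lambda^{-+}(y)+L\Lambda^{++}-\Omega(x)L-\bar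 F^{-+}(x)+\int_y^xK(x,s)\bar F^{-+}(s)ds+\int_y^xL(x,s)F^{++}ds,$$ $$\Sigma^-\Phi_x=\Phi A-\bar\Pi^-(x)-\Omega(x)\Phi-L(x,0)\Sigma^+D+\int_0^x\big(K(x,y)\bar\Pi^-(y)+L(x,y)\Pi^+\big)dy,$$ with the boundary conditions $$\Sigma^-L(x,x)+L(x,x)\Sigma^+=-\bar\Lambda^{-+}(x),\quad \Sigma^-K(x,x)-K(x,x)\Sigma^-=-\bar\Lambda^{--}(x)+\Omega(x),\quad K(x,0)\Sigma^-+L(x,0)\Sigma^+C=\Phi(x)B,$$ where $\Omega(x)$ is strictly lower triangular with $\omega_{ij}(x)=(s_i-s_j)K_{ij}(x,x)+\bar\Lambda^{--}_{ij}(x)$ for $i>j$. The equations for $K_{ij}$ and $L_{ij}$ are understood along characteristics: on each closed segment in $\mathcal T$ with direction $(s_i,s_j)$, respectively $(s_i,-\sigma_j^+)$, the entry is absolutely continuous and its derivative equals the right-hand side almost everywhere; $\Phi$ is absolutely continuous and satisfies its equation almost everywhere. If $s_j<s_i$, the two boundary conditions for $K_{ij}$ may be incompatible at the corner $(0,0)$;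 for these entries nothing is required at the corner, and the values of $K_{ij}$ on the line $s_iy=s_jx$ (where it may jump) are disregarded in the uniqueness statement. Then for every matrix $\Phi_0\in\mathbb R^{n\times m}$ the kernel equations have a bounded (Borel measurable) solution $(K,L,\Phi)$ with $\Phi(0)=\Phi_0$, and it is unique. Moreover there are positive numbers $\mathcal N,\mathcal M$ such that for all $i,j$ $$|K_{ij}(x,y)|\le\mathcal Ne^{\mathcal Mx},\qquad |L_{ij}(x,y)|\le\mathcal Ne^{\mathcal Mx}\quad((x,y)\in\mathcal T),\qquad |\Phi_{ij}(x)|\le\mathcal Ne^{\mathcal Mx}\quad(x\in[0,1]).$$ -/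

import Mathlib

open MeasureTheory Set

/-- Data of a linear `(m + n)` hyperbolic PIDE system with states `Z ∈ ℝᵐ`, `Y ∈ ℝⁿ`, coupled with
an ODE with state `X ∈ ℝᵐ`:

* `Z_t = -Σ⁺ Z_x + Λ⁺⁺ Z + Λ⁺⁻ Y + Π⁺ X + ∫₀ˣ (F⁺⁺ Z(y) + F⁺⁻ Y(y)) dy`,
* `Y_t = Σ⁻ Y_x + Λ⁻⁻ Y + Λ⁻⁺ Z + Π⁻ X + ∫₀ˣ (F⁻⁺ Z(y) + F⁻⁻ Y(y)) dy`,
* `X' = A X + B Y(0)`, `Z(0) = C Y(0) + D X`, `Y(1) = U`.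

`Σ⁺ = diag(sp)` and `Σ⁻ = diag(sm)`. The speeds `sm` are nonincreasing, so `Σ⁻` consists of scalar
blocks with strictly decreasing positive speeds; two states of `Y` are in the same (isotachic)
block exactly when their speeds `sm` are equal. -/
structure Plant (n m : ℕ) where
  /-- diagonal of `Σ⁻` -/
  sm : Fin n → ℝ
  /-- diagonal of `Σ⁺` -/
  sp : Fin m → ℝ
  sm_pos : ∀ i, 0 < sm i
  sm_anti : Antitone sm
  sp_pos : ∀ i, 0 < sp i
  sp_mono : Monotone sp
  Lpp : Matrix (Fin m) (Fin m) ℝ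
  Lpm : Matrix (Fin m) (Fin n) ℝ
  Lmp : Matrix (Fin n) (Fin m) ℝ
  Lmm : Matrix (Fin n) (Fin n) ℝ
  Fpp : Matrix (Fin m) (Fin m) ℝ
  Fpm : Matrix (Fin m) (Fin n) ℝ
  Fmp : Matrix (Fin n) (Fin m) ℝ
  Fmm : Matrix (Fin n) (Fin n) ℝ
  Pp : Matrix (Fin m) (Fin m) ℝ
  Pm : Matrix (Fin n) (Fin m) ℝ
  A : Matrix (Fin m) (Fin m) ℝ
  B : Matrix (Fin m) (Fin n) ℝ
  C : Matrix (Fin m) (Fin n) ℝ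
  D : Matrix (Fin m) (Fin m) ℝ

/-- The triangle `{(x, y) | 0 ≤ y ≤ x ≤ 1}` on which the kernels live. -/
def Tri : Set (ℝ × ℝ) := {p | 0 ≤ p.2 ∧ p.2 ≤ p.1 ∧ p.1 ≤ 1}

namespace Plant

variable {n m : ℕ} (P : Plant n m)

/-- `Σ⁻` -/
def Sm : Matrix (Fin n) (Fin n) ℝ := Matrix.diagonal P.sm

/-- `Σ⁺` -/
def Sp : Matrix (Fin m) (Fin m) ℝ := Matrix.diagonal P.sp

/-- The block diagonal part `diag(Λ⁻⁻₁, …, Λ⁻⁻_κ)` of `Λ⁻⁻`: the coupling inside the blocks. -/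
noncomputable def Lblk : Matrix (Fin n) (Fin n) ℝ :=
  Matrix.of fun i j => if P.sm i = P.sm j then P.Lmm i j else 0

/-- `(Σ⁻)⁻¹ diag(Λ⁻⁻₁, …, Λ⁻⁻_κ)`, whose `j`-th diagonal block is `Λ⁻⁻_j / σ⁻_j`. -/
noncomputable def gen : Matrix (Fin n) (Fin n) ℝ :=
  Matrix.of fun i j => P.Lblk i j / P.sm i

/-- The block transformation `𝒜(x)`, the solution of `𝒜' = 𝒜 (Σ⁻)⁻¹ diag(Λ⁻⁻_j)`, `𝒜(0) = I`
(see `cA_zero` and `hasDerivAt_cA`). -/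
noncomputable def cA (x : ℝ) : Matrix (Fin n) (Fin n) ℝ := NormedSpace.exp (x • P.gen)

/-- The inverse `𝒜(x)⁻¹` (see `cA_mul_cAinv`). -/
noncomputable def cAinv (x : ℝ) : Matrix (Fin n) (Fin n) ℝ := NormedSpace.exp ((-x) • P.gen)

theorem cA_zero : P.cA 0 = 1 := by
  simp [cA]

theorem cA_mul_cAinv (x : ℝ) : P.cA x * P.cAinv x = 1 := by
  unfold cA cAinv
  rw [← Matrix.exp_add_of_commute]
  · simp
  · exact (Commute.refl P.gen).smul_left x |>.smul_right (-x)

theorem hasDerivAt_cA (x : ℝ) (i j : Fin n) :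
    HasDerivAt (fun r => P.cA r i j) ((P.cA x * P.gen) i j) x := by
  let _ := Matrix.linftyOpNormedRing (n := Fin n) (α := ℝ)
  let _ := Matrix.linftyOpNormedAlgebra (n := Fin n) (R := ℝ) (α := ℝ)
  have h : HasDerivAt (fun r : ℝ => NormedSpace.exp (r • P.gen))
      (NormedSpace.exp (x • P.gen) * P.gen) x := hasDerivAt_exp_smul_const P.gen x
  exact (hasDerivAt_pi.1 ((hasDerivAt_pi.1 h) i)) j

/-- `Λ̄⁻⁻(x)`: the coupling of the `Y`-states after the block transformation, which removes the
coupling inside the blocks. -/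
noncomputable def bLmm (x : ℝ) : Matrix (Fin n) (Fin n) ℝ :=
  P.cA x * (P.Lmm - P.Lblk) * P.cAinv x

/-- `Λ̄⁺⁻(x)` -/
noncomputable def bLpm (x : ℝ) : Matrix (Fin m) (Fin n) ℝ := P.Lpm * P.cAinv x

/-- `Λ̄⁻⁺(x)` -/
noncomputable def bLmp (x : ℝ) : Matrix (Fin n) (Fin m) ℝ := P.cA x * P.Lmp

/-- `Π̄⁻(x)` -/
noncomputable def bPm (x : ℝ) : Matrix (Fin n) (Fin m) ℝ := P.cA x * P.Pm

/-- `F̄⁺⁻(y)` -/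
noncomputable def bFpm (y : ℝ) : Matrix (Fin m) (Fin n) ℝ := P.Fpm * P.cAinv y

/-- `F̄⁻⁺(x)` -/
noncomputable def bFmp (x : ℝ) : Matrix (Fin n) (Fin m) ℝ := P.cA x * P.Fmp

/-- `F̄⁻⁻(x, y)` -/
noncomputable def bFmm (x y : ℝ) : Matrix (Fin n) (Fin n) ℝ := P.cA x * P.Fmm * P.cAinv y

/-- The strictly lower triangular matrix `Ω(x)` determined by the diagonal values of `K`:
`ω_{ij}(x) = (Σ⁻_{ii} - Σ⁻_{jj}) K_{ij}(x, x) + Λ̄⁻⁻_{ij}(x)` for `i > j`. -/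
noncomputable def Omega (K : ℝ → ℝ → Matrix (Fin n) (Fin n) ℝ) (x : ℝ) :
    Matrix (Fin n) (Fin n) ℝ :=
  Matrix.of fun i j => if j < i then (P.sm i - P.sm j) * K x x i j + P.bLmm x i j else 0

/-- Right-hand side of the equation for `Σ⁻ K_x + K_y Σ⁻`. -/
noncomputable def rhsK (K : ℝ → ℝ → Matrix (Fin n) (Fin n) ℝ)
    (L : ℝ → ℝ → Matrix (Fin n) (Fin m) ℝ) (x y : ℝ) : Matrix (Fin n) (Fin n) ℝ :=
  K x y * P.bLmm y - L x y * P.bLpm y - P.Omega K x * K x y - P.bFmm x y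
    + Matrix.of (fun i j => ∫ s in y..x, (K x s * P.bFmm s y) i j)
    + Matrix.of (fun i j => ∫ s in y..x, (L x s * P.bFpm y) i j)

/-- Right-hand side of the equation for `Σ⁻ L_x - L_y Σ⁺`. -/
noncomputable def rhsL (K : ℝ → ℝ → Matrix (Fin n) (Fin n) ℝ)
    (L : ℝ → ℝ → Matrix (Fin n) (Fin m) ℝ) (x y : ℝ) : Matrix (Fin n) (Fin m) ℝ :=
  K x y * P.bLmp y + L x y * P.Lpp - P.Omega K x * L x y - P.bFmp x
    + Matrix.of (fun i j => ∫ s in y..x, (K x s * P.bFmp s) i j)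
    + Matrix.of (fun i j => ∫ s in y..x, (L x s * P.Fpp) i j)

/-- Right-hand side of the equation for `Σ⁻ Φ_x`. -/
noncomputable def rhsPhi (K : ℝ → ℝ → Matrix (Fin n) (Fin n) ℝ)
    (L : ℝ → ℝ → Matrix (Fin n) (Fin m) ℝ) (Phi : ℝ → Matrix (Fin n) (Fin m) ℝ) (x : ℝ) :
    Matrix (Fin n) (Fin m) ℝ :=
  Phi x * P.A - P.bPm x - P.Omega K x * Phi x - L x 0 * P.Sp * P.D
    + Matrix.of (fun i j => ∫ y in (0 : ℝ)..x, (K x y * P.bPm y + L x y * P.Pp) i j)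

/-- `(K, L, Φ)` is a bounded solution of the kernel equations with `Φ(0) = Phi0`. The equations are
understood along characteristics (solutions in the broad sense): the `(i, j)` entries of
`Σ⁻ K_x + K_y Σ⁻` and `Σ⁻ L_x - L_y Σ⁺` are the derivatives of `K_{ij}` and `L_{ij}` in the
directions `(sm i, sm j)` and `(sm i, -sp j)`; on each closed segment of the triangle with this
direction the entry is absolutely continuous, and its derivative is the right-hand side almost
everywhere on the segment.

If `sm j < sm i`, the conditions for `K_{ij}` on the diagonal and on `y = 0` in general contradict
each other at the corner `(0, 0)`, so that `K_{ij}` jumps across the characteristic issuing from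
the corner; nothing is then required of `K_{ij}` at the corner itself. This is the role of the
clauses `0 < x ∨ sm i ≤ sm j` and of the half-open interval in `diagK`. -/
structure IsBoundedKernelSolution (Phi0 : Matrix (Fin n) (Fin m) ℝ)
    (K : ℝ → ℝ → Matrix (Fin n) (Fin n) ℝ) (L : ℝ → ℝ → Matrix (Fin n) (Fin m) ℝ)
    (Phi : ℝ → Matrix (Fin n) (Fin m) ℝ) : Prop where
  measurable_K : ∀ i j, Measurable (Tri.domRestrict fun p => K p.1 p.2 i j)
  measurable_L : ∀ i j, Measurable (Tri.domRestrict fun p => L p.1 p.2 i j)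
  bounded_K : ∃ b : ℝ, ∀ p ∈ Tri, ∀ i j, |K p.1 p.2 i j| ≤ b
  bounded_L : ∃ b : ℝ, ∀ p ∈ Tri, ∀ i j, |L p.1 p.2 i j| ≤ b
  bounded_Phi : ∃ b : ℝ, ∀ x ∈ Icc (0 : ℝ) 1, ∀ i j, |Phi x i j| ≤ b
  /-- `Σ⁻ K_x + K_y Σ⁻ = …` -/
  eqK : ∀ i j, ∀ x y t : ℝ, 0 ≤ t → (x, y) ∈ Tri → (x + P.sm i * t, y + P.sm j * t) ∈ Tri →
    (0 < x ∨ P.sm i ≤ P.sm j) →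
    AbsolutelyContinuousOnInterval (fun r => K (x + P.sm i * r) (y + P.sm j * r) i j) 0 t ∧
    ∀ᵐ s : ℝ, s ∈ Ioo 0 t →
      HasDerivAt (fun r => K (x + P.sm i * r) (y + P.sm j * r) i j)
        (P.rhsK K L (x + P.sm i * s) (y + P.sm j * s) i j) s
  /-- `Σ⁻ L_x - L_y Σ⁺ = …` -/
  eqL : ∀ i j, ∀ x y t : ℝ, 0 ≤ t → (x, y) ∈ Tri → (x + P.sm i * t, y - P.sp j * t) ∈ Tri →
    AbsolutelyContinuousOnInterval (fun r => L (x + P.sm i * r) (y - P.sp j * r) i j) 0 t ∧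
    ∀ᵐ s : ℝ, s ∈ Ioo 0 t →
      HasDerivAt (fun r => L (x + P.sm i * r) (y - P.sp j * r) i j)
        (P.rhsL K L (x + P.sm i * s) (y - P.sp j * s) i j) s
  /-- `Σ⁻ Φ_x = …` -/
  eqPhi : ∀ i j, AbsolutelyContinuousOnInterval (fun r => Phi r i j) 0 1 ∧
    ∀ᵐ x : ℝ, x ∈ Ioo (0 : ℝ) 1 →
      ∃ d : ℝ, HasDerivAt (fun r => Phi r i j) d x ∧ P.sm i * d = P.rhsPhi K L Phi x i j
  /-- `Σ⁻ L(x, x) + L(x, x) Σ⁺ = -Λ̄⁻⁺(x)` -/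
  diagL : ∀ x ∈ Icc (0 : ℝ) 1, P.Sm * L x x + L x x * P.Sp = -P.bLmp x
  /-- `Σ⁻ K(x, x) - K(x, x) Σ⁻ = -Λ̄⁻⁻(x) + Ω(x)` -/
  diagK : ∀ x ∈ Ioc (0 : ℝ) 1, P.Sm * K x x - K x x * P.Sm = -P.bLmm x + P.Omega K x
  /-- `K(x, 0) Σ⁻ + L(x, 0) Σ⁺ C = Φ(x) B` -/
  bottom : ∀ i j, ∀ x ∈ Icc (0 : ℝ) 1, (0 < x ∨ P.sm i ≤ P.sm j) →
    (K x 0 * P.Sm + L x 0 * P.Sp * P.C) i j = (Phi x * P.B) i j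
  init : Phi 0 = Phi0

end Plant

/-! ### Weighted Picard iteration and auxiliary measure theory. -/

section Abstract

open Filter Topology

/-! The system looks quadratic, because `Ω` contains diagonal values of `K` and multiplies `K`, `L`
and `Φ`. But `Ω` is strictly lower triangular: in row `i` it produces only products of a trace
`K_{ik}(x,x)`, `k < i`, from row `i` with entries of row `k`. Once the rows `k < i` are known, row
`i` of `(K, L, Φ)` solves a linear system (`sum_Omega`, `rowRhs_eq_linearRhs`), so the rows can be
solved successively (`exists_rows`).

In row `i` every unknown is transported with the same speed `s_i` in `x`, and the right-hand side at
abscissa `x` uses the unknowns at that abscissa only: local values, traces at `(x,x)`, and integrals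
over part of the vertical slice. The integrated system is therefore of Volterra type in `x`, and in
the weight `exp (M x)` integration along characteristics gains a factor `1 / (M s_i)`. The condition
on `y = 0` gains nothing in this way, since it expresses `K(x,0)` by `L(x,0)` and `Φ(x)` at the same
`x`; it is made contractive by giving `K` a large constant weight. Together the two contributions
contract by `1/2` (`CharSystem.exists_contraction`).

Boundary data are attached to characteristics by the order of the speeds. The `L` characteristics
enter through the diagonal. For `s_i ≤ s_j` those of `K_{ij}` enter through `y = 0`, and the
diagonal condition is either the definition of `Ω` or trivial, the block transformation having
removed the coupling inside blocks. For `s_j < s_i` they enter through `y = 0` or the diagonal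
according to the side of the line through the corner; this is where a jump can occur.

For uniqueness, an arbitrary solution is integrated along characteristics. Its values on the jump
lines are replaced by those of the constructed solution; this leaves the integrated equations
unchanged, as jump lines meet vertical lines, and the other characteristics in use, in null sets.
Comparison by the contraction, row by row, finishes the proof. The exponential bound is immediate
from boundedness on `[0,1]`. -/

theorem exists_fixedPoint_of_weighted_contraction {ι E : Type*} (S : Set (ι → E → ℝ))
    (w : ι → E → ℝ) (T : (ι → E → ℝ) → ι → E → ℝ) (hT : ∀ u ∈ S, T u ∈ S)
    (hc : ∀ u ∈ S, ∀ v ∈ S, ∀ c : ℝ, 0 ≤ c → (∀ i z, |u i z - v i z| ≤ c * w i z) →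
      ∀ i z, |T u i z - T v i z| ≤ c / 2 * w i z)
    (u₀ : ι → E → ℝ) (hu₀ : u₀ ∈ S) (c₀ : ℝ) (hc₀ : 0 ≤ c₀)
    (h₀ : ∀ i z, |T u₀ i z - u₀ i z| ≤ c₀ * w i z)
    (hS : ∀ (u : ℕ → ι → E → ℝ) (l : ι → E → ℝ), (∀ k, u k ∈ S) →
      (∀ i z, |u 0 i z - l i z| ≤ 2 * c₀ * w i z) →
      (∀ i z, Tendsto (fun k => u k i z) atTop (𝓝 (l i z))) → l ∈ S) :
    ∃ l ∈ S, T l = l := by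
  set u : ℕ → ι → E → ℝ := fun k => T^[k] u₀ with hu
  have usucc : ∀ k, u (k + 1) = T (u k) := fun k => Function.iterate_succ_apply' T k u₀
  have uS : ∀ k, u k ∈ S := by
    intro k
    induction k with
    | zero => exact hu₀
    | succ k ih => rw [usucc]; exact hT _ ih
  have step : ∀ k i z, |u (k + 1) i z - u k i z| ≤ c₀ * (1 / 2) ^ k * w i z := by
    intro k
    induction k with
    | zero => intro i z; simpa [hu] using h₀ i z
    | succ k ih =>
      intro i z
      rw [usucc (k + 1), usucc k]
      refine (hc _ (by rw [← usucc]; exact uS _) _ (uS k) (c₀ * (1 / 2) ^ k) (by positivity)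
        (by rw [← usucc]; exact ih) i z).trans (le_of_eq ?_)
      ring
  have geo : ∀ i z k, dist (u k i z) (u (k + 1) i z) ≤ c₀ * w i z * (1 / 2) ^ k := by
    intro i z k
    rw [dist_comm, Real.dist_eq]
    exact (step k i z).trans (le_of_eq (by ring))
  have hlim : ∀ i z, ∃ l, Tendsto (fun k => u k i z) atTop (𝓝 l) := fun i z =>
    cauchySeq_tendsto_of_complete
      (cauchySeq_of_le_geometric (1 / 2) (c₀ * w i z) (by norm_num) (geo i z))
  choose l hl using hlim
  have hdist : ∀ k i z, |u k i z - l i z| ≤ 2 * c₀ * (1 / 2) ^ k * w i z := by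
    intro k i z
    have := dist_le_of_le_geometric_of_tendsto (1 / 2) (c₀ * w i z) (by norm_num) (geo i z)
      (hl i z) k
    rw [Real.dist_eq] at this
    exact this.trans (le_of_eq (by ring))
  -- The distance to the initial iterate is what lets a caller bound the limit: pointwise
  -- convergence alone would not keep it in a class of bounded functions.
  have lS : l ∈ S := hS u l uS (fun i z => by simpa using hdist 0 i z) hl
  refine ⟨l, lS, ?_⟩
  funext i z
  -- The contraction estimate for the pair `u k`, `l` makes `T (u k)` converge to `T l`; being the
  -- shifted sequence of iterates, it also converges to `l`.
  have h1 : Tendsto (fun k => u (k + 1) i z) atTop (𝓝 (T l i z)) := by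
    rw [tendsto_iff_dist_tendsto_zero]
    refine squeeze_zero (fun _ => dist_nonneg)
      (g := fun k : ℕ => c₀ * w i z * (1 / 2 : ℝ) ^ k) (fun k => ?_) ?_
    · rw [Real.dist_eq, usucc]
      refine (hc _ (uS k) _ lS (2 * c₀ * (1 / 2) ^ k) (by positivity) (hdist k) i z).trans
        (le_of_eq (by ring))
    · have := tendsto_pow_atTop_nhds_zero_of_lt_one (r := (1 / 2 : ℝ)) (by norm_num) (by norm_num)
      simpa using this.const_mul (c₀ * w i z)
  exact tendsto_nhds_unique h1 ((tendsto_add_atTop_iff_nat 1).2 (hl i z))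

/-- A signed integral is a difference of two integrals over `Ioc`. Each is the integral over the
whole line of a jointly measurable function cut off by an indicator, so the measurability part of
Fubini's theorem applies. -/
theorem measurable_intervalIntegral_param {X : Type*} [MeasurableSpace X] {p q : X → ℝ}
    (hp : Measurable p) (hq : Measurable q) {f : X → ℝ → ℝ}
    (hf : Measurable (Function.uncurry f)) : Measurable fun x => ∫ s in p x..q x, f x s := by
  have key : ∀ {p q : X → ℝ}, Measurable p → Measurable q →
      Measurable fun x => ∫ s in Ioc (p x) (q x), f x s := by
    intro p q hp hq
    have h : (fun x => ∫ s in Ioc (p x) (q x), f x s) =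
        fun x => ∫ s, {z : X × ℝ | p z.1 < z.2 ∧ z.2 ≤ q z.1}.indicator (Function.uncurry f)
          (x, s) := by
      funext x
      rw [← integral_indicator measurableSet_Ioc]
      rfl
    rw [h]
    refine (StronglyMeasurable.integral_prod_right' (ν := volume) ?_).measurable
    refine (hf.indicator ?_).stronglyMeasurable
    exact (measurableSet_lt (hp.comp measurable_fst) measurable_snd).inter
      (measurableSet_le measurable_snd (hq.comp measurable_fst))
  exact (key hp hq).sub (key hq hp)

theorem intervalIntegrable_of_bounded {f : ℝ → ℝ} (hf : Measurable f) {p q b : ℝ}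
    (hb : ∀ s ∈ uIcc p q, |f s| ≤ b) : IntervalIntegrable f volume p q := by
  refine (intervalIntegrable_const (c := b)).mono_fun' hf.aestronglyMeasurable ?_
  refine (ae_restrict_mem measurableSet_uIoc).mono fun s hs => ?_
  exact hb s (uIoc_subset_uIcc hs)

/-- The gain `1 / (M * a)`, uniform in the length `τ` of the characteristic, is the source of the
contraction. -/
theorem integral_exp_affine_le {M a x τ : ℝ} (hM : 0 < M) (ha : 0 < a) :
    ∫ r in (-τ)..0, Real.exp (M * (x + a * r)) ≤ Real.exp (M * x) / (M * a) := by
  have hne : M * a ≠ 0 := by positivity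
  have hd : ∀ r : ℝ, HasDerivAt (fun r => Real.exp (M * (x + a * r)) / (M * a))
      (Real.exp (M * (x + a * r))) r := by
    intro r
    have h := ((((hasDerivAt_id r).const_mul a).const_add x).const_mul M).exp.div_const (M * a)
    refine h.congr_deriv ?_
    simp only [id]
    field_simp
  rw [intervalIntegral.integral_eq_sub_of_hasDerivAt (fun r _ => hd r)
    (Continuous.intervalIntegrable (by fun_prop) _ _)]
  have : 0 ≤ Real.exp (M * (x + a * -τ)) / (M * a) := by positivity
  simp only [mul_zero, add_zero]
  linarith

/-- Fundamental theorem of calculus along a segment, with a prescribed a.e. derivative. -/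
theorem AbsolutelyContinuousOnInterval.sub_eq_integral_of_ae_hasDerivAt {f φ : ℝ → ℝ} {t : ℝ}
    (ht : 0 ≤ t) (hf : AbsolutelyContinuousOnInterval f 0 t)
    (hd : ∀ᵐ s : ℝ, s ∈ Ioo 0 t → HasDerivAt f (φ s) s) :
    f t - f 0 = ∫ s in (0 : ℝ)..t, φ s := by
  rw [← hf.integral_deriv_eq_sub]
  refine intervalIntegral.integral_congr_ae ?_
  have hne : ∀ᵐ s : ℝ, s ≠ t := by simp [ae_iff, measure_singleton]
  filter_upwards [hd, hne] with s hs hst hmem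
  rw [uIoc_of_le ht] at hmem
  exact (hs ⟨hmem.1, lt_of_le_of_ne hmem.2 hst⟩).deriv

theorem exists_uniform_bound {κ : Type*} [Finite κ] {X : Type*} {s : Set X} {f : κ → X → ℝ}
    (h : ∀ k, ∃ b, ∀ x ∈ s, |f k x| ≤ b) : ∃ b, 0 ≤ b ∧ ∀ k, ∀ x ∈ s, |f k x| ≤ b := by
  choose b hb using h
  obtain ⟨B, hB⟩ := (Set.finite_range b).bddAbove
  exact ⟨max B 0, le_max_right _ _, fun k x hx =>
    (hb k x hx).trans ((hB ⟨k, rfl⟩).trans (le_max_left _ _))⟩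

end Abstract

/-! ### Transport systems along characteristics: well-posedness in integrated form. -/

section CharacteristicSystem

open Filter Topology

/-- Families of bounded measurable functions, the `c`-th one vanishing outside `D c`. -/
def boundedFamilies {ι : Type*} (D : ι → Set (ℝ × ℝ)) : Set (ι → ℝ × ℝ → ℝ) :=
  {v | (∀ c, Measurable (v c)) ∧ (∀ c, ∀ z ∉ D c, v c z = 0) ∧ ∃ b, 0 ≤ b ∧ ∀ c z, |v c z| ≤ b}

/-- A semilinear transport system: the `c`-th unknown is transported with velocity `(a, e c)` in the
domain `D c`, which it enters at the time `-τ c z` before reaching `z`. At the entrance point it is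
`g c + ∑ c', ρ c c' v c'`, and its derivative along the characteristic is `F v c`. The right-hand
side at the abscissa `x` depends on the values of the unknowns at the abscissa `x` only. -/
structure CharSystem (ι : Type*) [Fintype ι] where
  a : ℝ
  e : ι → ℝ
  D : ι → Set (ℝ × ℝ)
  τ : ι → ℝ × ℝ → ℝ
  g : ι → ℝ × ℝ → ℝ
  ρ : ι → ι → ℝ × ℝ → ℝ
  ω : ι → ℝ
  F : (ι → ℝ × ℝ → ℝ) → ι → ℝ × ℝ → ℝ
  a_pos : 0 < a
  measurableSet_D : ∀ c, MeasurableSet (D c)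
  fst_mem : ∀ c, ∀ z ∈ D c, 0 ≤ z.1 ∧ z.1 ≤ 1
  measurable_τ : ∀ c, Measurable (τ c)
  τ_nonneg : ∀ c, ∀ z ∈ D c, 0 ≤ τ c z
  segment_mem : ∀ c, ∀ z ∈ D c, ∀ r ∈ Icc (-τ c z) 0, (z.1 + a * r, z.2 + e c * r) ∈ D c
  measurable_g : ∀ c, Measurable (g c)
  bounded_g : ∃ b, 0 ≤ b ∧ ∀ c, ∀ z ∈ D c, |g c z| ≤ b
  measurable_ρ : ∀ c c', Measurable (ρ c c')
  one_le_ω : ∀ c, 1 ≤ ω c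
  ρ_le : ∀ c, ∀ z ∈ D c, ∑ c', |ρ c c' z| * ω c' ≤ ω c / 4
  measurable_F : ∀ v, (∀ c, Measurable (v c)) → ∀ c, Measurable (F v c)
  bounded_F_zero : ∃ b, 0 ≤ b ∧ ∀ c, ∀ z ∈ D c, |F 0 c z| ≤ b
  lipschitz_F : ∃ C, 0 ≤ C ∧ ∀ v ∈ boundedFamilies D, ∀ v' ∈ boundedFamilies D, ∀ c, ∀ z ∈ D c,
    ∀ δ : ℝ, 0 ≤ δ → (∀ c' y, |v c' (z.1, y) - v' c' (z.1, y)| ≤ δ) →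
      |F v c z - F v' c z| ≤ C * δ

namespace CharSystem

variable {ι : Type*} [Fintype ι] (S : CharSystem ι)

theorem zero_mem : (0 : ι → ℝ × ℝ → ℝ) ∈ boundedFamilies S.D :=
  ⟨fun _ => measurable_const, fun _ _ _ => rfl, 0, le_rfl, fun _ _ => by simp⟩

/-- The point reached from `z` after the time `r` along the `c`-th characteristic. -/
def flow (c : ι) (z : ℝ × ℝ) (r : ℝ) : ℝ × ℝ := (z.1 + S.a * r, z.2 + S.e c * r)

theorem measurable_flow (c : ι) : Measurable (Function.uncurry (S.flow c)) := by
  unfold flow Function.uncurry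
  fun_prop

theorem flow_flow (c : ι) (z : ℝ × ℝ) (r s : ℝ) :
    S.flow c (S.flow c z r) s = S.flow c z (r + s) := by
  simp only [flow]; ext <;> simp <;> ring

@[simp] theorem flow_zero (c : ι) (z : ℝ × ℝ) : S.flow c z 0 = z := by
  simp [flow]

/-- The entrance point of the `c`-th characteristic through `z`. -/
def entry (c : ι) (z : ℝ × ℝ) : ℝ × ℝ := S.flow c z (-S.τ c z)

theorem measurable_entry (c : ι) : Measurable (S.entry c) :=
  (S.measurable_flow c).comp (measurable_id.prodMk (S.measurable_τ c).neg)

theorem entry_mem {c : ι} {z : ℝ × ℝ} (hz : z ∈ S.D c) : S.entry c z ∈ S.D c :=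
  S.segment_mem c z hz _ ⟨le_rfl, by simpa using S.τ_nonneg c z hz⟩

/-- The value prescribed at the entrance point of the characteristic. -/
def bdry (v : ι → ℝ × ℝ → ℝ) (c : ι) (z : ℝ × ℝ) : ℝ :=
  S.g c (S.entry c z) + ∑ c', S.ρ c c' (S.entry c z) * v c' (S.entry c z)

open scoped Classical in
/-- The operator whose fixed points are the solutions of the system. -/
noncomputable def op (v : ι → ℝ × ℝ → ℝ) (c : ι) (z : ℝ × ℝ) : ℝ :=
  if z ∈ S.D c then S.bdry v c z + ∫ r in (-S.τ c z)..0, S.F v c (S.flow c z r) else 0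

theorem op_of_mem (v : ι → ℝ × ℝ → ℝ) {c : ι} {z : ℝ × ℝ} (hz : z ∈ S.D c) :
    S.op v c z = S.bdry v c z + ∫ r in (-S.τ c z)..0, S.F v c (S.flow c z r) := if_pos hz

theorem op_of_notMem (v : ι → ℝ × ℝ → ℝ) {c : ι} {z : ℝ × ℝ} (hz : z ∉ S.D c) :
    S.op v c z = 0 := if_neg hz

theorem exists_bound_F {v : ι → ℝ × ℝ → ℝ} (hv : v ∈ boundedFamilies S.D) :
    ∃ b, 0 ≤ b ∧ ∀ c, ∀ z ∈ S.D c, |S.F v c z| ≤ b := by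
  obtain ⟨b, hb, hvb⟩ := hv.2.2
  obtain ⟨b₀, hb₀, h0⟩ := S.bounded_F_zero
  obtain ⟨C, hC, hlip⟩ := S.lipschitz_F
  refine ⟨C * b + b₀, by positivity, fun c z hz => ?_⟩
  have h1 := hlip v hv 0 S.zero_mem c z hz b hb (fun c' y => by simpa using hvb c' (z.1, y))
  have h2 := h0 c z hz
  have := abs_add_le (S.F v c z - S.F 0 c z) (S.F 0 c z)
  rw [sub_add_cancel] at this
  linarith

theorem measurable_F_flow {v : ι → ℝ × ℝ → ℝ} (hv : v ∈ boundedFamilies S.D) (c : ι)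
    (z : ℝ × ℝ) : Measurable fun r => S.F v c (S.flow c z r) :=
  (S.measurable_F v hv.1 c).comp ((S.measurable_flow c).comp measurable_prodMk_left)

theorem intervalIntegrable_F_flow {v : ι → ℝ × ℝ → ℝ} (hv : v ∈ boundedFamilies S.D) {c : ι}
    {z : ℝ × ℝ} {p q : ℝ} (hpq : ∀ r ∈ uIcc p q, S.flow c z r ∈ S.D c) :
    IntervalIntegrable (fun r => S.F v c (S.flow c z r)) volume p q := by
  obtain ⟨b, -, hb⟩ := S.exists_bound_F hv
  exact intervalIntegrable_of_bounded (S.measurable_F_flow hv c z)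
    (fun r hr => hb c _ (hpq r hr))

theorem flow_mem {c : ι} {z : ℝ × ℝ} (hz : z ∈ S.D c) :
    ∀ r ∈ uIcc (-S.τ c z) 0, S.flow c z r ∈ S.D c := by
  intro r hr
  rw [uIcc_of_le (by simpa using S.τ_nonneg c z hz)] at hr
  exact S.segment_mem c z hz r hr

theorem op_mem {v : ι → ℝ × ℝ → ℝ} (hv : v ∈ boundedFamilies S.D) :
    S.op v ∈ boundedFamilies S.D := by
  refine ⟨fun c => ?_, fun c z hz => S.op_of_notMem v hz, ?_⟩
  · unfold op
    refine Measurable.ite (S.measurableSet_D c) (Measurable.add ?_ ?_) measurable_const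
    · unfold bdry
      refine ((S.measurable_g c).comp (S.measurable_entry c)).add
        (Finset.measurable_sum _ fun c' _ => ?_)
      exact ((S.measurable_ρ c c').comp (S.measurable_entry c)).mul
        ((hv.1 c').comp (S.measurable_entry c))
    · exact measurable_intervalIntegral_param (S.measurable_τ c).neg measurable_const
        (f := fun z r => S.F v c (S.flow c z r))
        ((S.measurable_F v hv.1 c).comp (S.measurable_flow c))
  · obtain ⟨b, hb, hvb⟩ := hv.2.2
    obtain ⟨bg, hbg, hg⟩ := S.bounded_g
    obtain ⟨bF, hbF, hF⟩ := S.exists_bound_F hv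
    have hω : 0 ≤ ∑ c, S.ω c := Finset.sum_nonneg fun c _ => zero_le_one.trans (S.one_le_ω c)
    have ha := S.a_pos
    refine ⟨bg + (∑ c, S.ω c) / 4 * b + bF / S.a, by positivity, fun c z => ?_⟩
    by_cases hz : z ∈ S.D c
    · rw [S.op_of_mem v hz, bdry]
      have hz' := S.entry_mem hz
      have h1 := hg c _ hz'
      have h2 : |∑ c', S.ρ c c' (S.entry c z) * v c' (S.entry c z)| ≤ (∑ c, S.ω c) / 4 * b := by
        calc |∑ c', S.ρ c c' (S.entry c z) * v c' (S.entry c z)|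
            ≤ ∑ c', |S.ρ c c' (S.entry c z) * v c' (S.entry c z)| :=
              Finset.abs_sum_le_sum_abs _ _
          _ ≤ ∑ c', |S.ρ c c' (S.entry c z)| * S.ω c' * b := by
              refine Finset.sum_le_sum fun c' _ => ?_
              rw [abs_mul]
              refine mul_le_mul ?_ (hvb c' _) (abs_nonneg _) ?_
              · exact le_mul_of_one_le_right (abs_nonneg _) (S.one_le_ω c')
              · exact mul_nonneg (abs_nonneg _) (zero_le_one.trans (S.one_le_ω c'))
          _ = (∑ c', |S.ρ c c' (S.entry c z)| * S.ω c') * b := by rw [Finset.sum_mul]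
          _ ≤ (∑ c, S.ω c) / 4 * b := by
              refine mul_le_mul_of_nonneg_right ((S.ρ_le c _ hz').trans ?_) hb
              have := Finset.single_le_sum (f := S.ω)
                (fun c _ => zero_le_one.trans (S.one_le_ω c)) (Finset.mem_univ c)
              linarith
      have h3 : |∫ r in (-S.τ c z)..0, S.F v c (S.flow c z r)| ≤ bF / S.a := by
        have h := intervalIntegral.norm_integral_le_of_norm_le_const
          (a := -S.τ c z) (b := 0) (C := bF) (f := fun r => S.F v c (S.flow c z r))
          (fun r hr => hF c _ (S.flow_mem hz r (uIoc_subset_uIcc hr)))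
        refine h.trans ?_
        have hτ := S.τ_nonneg c z hz
        rw [zero_sub, neg_neg, abs_of_nonneg hτ, div_eq_mul_one_div]
        refine mul_le_mul_of_nonneg_left ?_ hbF
        -- The characteristic moves with speed `a` from an abscissa at least `0` to one at most `1`,
        -- so its duration is at most `1 / a`.
        have e1 := (S.fst_mem c _ hz').1
        have e2 := (S.fst_mem c _ hz).2
        simp only [entry, flow] at e1
        rw [le_div_iff₀ ha]
        nlinarith
      have := abs_add_le (S.g c (S.entry c z)) (∑ c', S.ρ c c' (S.entry c z) * v c' (S.entry c z))
      refine (abs_add_le _ _).trans ?_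
      linarith
    · rw [S.op_of_notMem v hz, abs_zero]
      positivity

open scoped Classical in
/-- The weight in which the operator `op` is a contraction, if `M` is large. -/
noncomputable def weight (M : ℝ) (c : ι) (z : ℝ × ℝ) : ℝ :=
  if z ∈ S.D c then S.ω c * Real.exp (M * z.1) else 0

theorem weight_of_mem (M : ℝ) {c : ι} {z : ℝ × ℝ} (hz : z ∈ S.D c) :
    S.weight M c z = S.ω c * Real.exp (M * z.1) := if_pos hz

theorem weight_of_notMem (M : ℝ) {c : ι} {z : ℝ × ℝ} (hz : z ∉ S.D c) :
    S.weight M c z = 0 := if_neg hz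

theorem weight_le {M : ℝ} (c : ι) (z : ℝ × ℝ) :
    S.weight M c z ≤ (∑ c, S.ω c) * Real.exp (M * z.1) := by
  have h : ∀ c, 0 ≤ S.ω c := fun c => zero_le_one.trans (S.one_le_ω c)
  have hs := Finset.single_le_sum (f := S.ω) (fun c _ => h c) (Finset.mem_univ c)
  by_cases hz : z ∈ S.D c
  · rw [S.weight_of_mem M hz]
    gcongr
  · rw [S.weight_of_notMem M hz]
    have := (h c).trans hs
    positivity

theorem one_le_weight {M : ℝ} (hM : 0 ≤ M) {c : ι} {z : ℝ × ℝ} (hz : z ∈ S.D c) :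
    1 ≤ S.weight M c z := by
  rw [S.weight_of_mem M hz]
  exact one_le_mul_of_one_le_of_one_le (S.one_le_ω c)
    (Real.one_le_exp (mul_nonneg hM (S.fst_mem c z hz).1))

/-- The factor `1/2` is shared equally. The boundary term contributes `1/4` through the constants
`ω`, whatever `M` is; the integral term contributes `1/4` through the exponential, for large `M`. -/
theorem exists_contraction : ∃ M : ℝ, 0 < M ∧ ∀ v ∈ boundedFamilies S.D,
    ∀ v' ∈ boundedFamilies S.D, ∀ k : ℝ, 0 ≤ k →
    (∀ c z, |v c z - v' c z| ≤ k * S.weight M c z) →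
    ∀ c z, |S.op v c z - S.op v' c z| ≤ k / 2 * S.weight M c z := by
  obtain ⟨C, hC, hlip⟩ := S.lipschitz_F
  have ha := S.a_pos
  have hω : 0 ≤ ∑ c, S.ω c := Finset.sum_nonneg fun c _ => zero_le_one.trans (S.one_le_ω c)
  set W := ∑ c, S.ω c with hW
  -- Chosen so that `C * W / (M * a) ≤ 1/4`; the summand `1` keeps `M` positive when `C = 0`.
  set M := 4 * C * W / S.a + 1 with hM
  have hMpos : 0 < M := by positivity
  refine ⟨M, hMpos, fun v hv v' hv' k hk hvv c z => ?_⟩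
  by_cases hz : z ∈ S.D c
  swap
  · rw [S.op_of_notMem _ hz, S.op_of_notMem _ hz, S.weight_of_notMem M hz]; simp
  rw [S.op_of_mem v hz, S.op_of_mem v' hz, S.weight_of_mem M hz]
  have hz' := S.entry_mem hz
  have hτ := S.τ_nonneg c z hz
  -- The entrance point lies to the left of `z`, so its exponential weight is at most that at `z`,
  -- and `ρ_le` supplies the factor `1/4`.
  have hB : |S.bdry v c z - S.bdry v' c z| ≤ k / 4 * (S.ω c * Real.exp (M * z.1)) := by
    have hx : (S.entry c z).1 ≤ z.1 := by
      simp only [entry, flow]; nlinarith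
    have : S.bdry v c z - S.bdry v' c z =
        ∑ c', S.ρ c c' (S.entry c z) * (v c' (S.entry c z) - v' c' (S.entry c z)) := by
      simp only [bdry, mul_sub, Finset.sum_sub_distrib]; ring
    rw [this]
    calc |∑ c', S.ρ c c' (S.entry c z) * (v c' (S.entry c z) - v' c' (S.entry c z))|
        ≤ ∑ c', |S.ρ c c' (S.entry c z) * (v c' (S.entry c z) - v' c' (S.entry c z))| :=
          Finset.abs_sum_le_sum_abs _ _
      _ ≤ ∑ c', |S.ρ c c' (S.entry c z)| * S.ω c' * (k * Real.exp (M * z.1)) := by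
          refine Finset.sum_le_sum fun c' _ => ?_
          rw [abs_mul, mul_assoc]
          refine mul_le_mul_of_nonneg_left ((hvv c' _).trans ?_) (abs_nonneg _)
          have h0 : 0 ≤ S.ω c' := zero_le_one.trans (S.one_le_ω c')
          have h1 : S.weight M c' (S.entry c z) ≤ S.ω c' * Real.exp (M * z.1) := by
            by_cases h : S.entry c z ∈ S.D c'
            · rw [S.weight_of_mem M h]; gcongr
            · rw [S.weight_of_notMem M h]; positivity
          calc k * S.weight M c' (S.entry c z) ≤ k * (S.ω c' * Real.exp (M * z.1)) := by gcongr
            _ = S.ω c' * (k * Real.exp (M * z.1)) := by ring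
      _ = (∑ c', |S.ρ c c' (S.entry c z)| * S.ω c') * (k * Real.exp (M * z.1)) := by
          rw [Finset.sum_mul]
      _ ≤ S.ω c / 4 * (k * Real.exp (M * z.1)) :=
          mul_le_mul_of_nonneg_right (S.ρ_le c _ hz') (by positivity)
      _ = k / 4 * (S.ω c * Real.exp (M * z.1)) := by ring
  have hI : |(∫ r in (-S.τ c z)..0, S.F v c (S.flow c z r)) -
      ∫ r in (-S.τ c z)..0, S.F v' c (S.flow c z r)| ≤ k / 4 * (S.ω c * Real.exp (M * z.1)) := by
    rw [← intervalIntegral.integral_sub (S.intervalIntegrable_F_flow hv (S.flow_mem hz))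
      (S.intervalIntegrable_F_flow hv' (S.flow_mem hz))]
    have hle : ∀ r ∈ Ioc (-S.τ c z) 0, ‖S.F v c (S.flow c z r) - S.F v' c (S.flow c z r)‖ ≤
        C * (k * W) * Real.exp (M * (z.1 + S.a * r)) := by
      intro r hr
      have hm : S.flow c z r ∈ S.D c := S.segment_mem c z hz r ⟨hr.1.le, hr.2⟩
      rw [Real.norm_eq_abs]
      refine (hlip v hv v' hv' c _ hm (k * (W * Real.exp (M * (z.1 + S.a * r))))
        (by positivity) fun c' y => ?_).trans (le_of_eq (by ring))
      refine (hvv c' _).trans ?_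
      gcongr
      exact S.weight_le c' _
    have h1 := intervalIntegral.norm_integral_le_of_norm_le (μ := volume) (by linarith)
      (Filter.Eventually.of_forall hle)
      (Continuous.intervalIntegrable (by fun_prop) _ _)
    rw [Real.norm_eq_abs] at h1
    refine h1.trans ?_
    rw [intervalIntegral.integral_const_mul]
    have h2 := integral_exp_affine_le (x := z.1) (τ := S.τ c z) hMpos ha
    have h3 : C * W ≤ M * S.a / 4 := by
      rw [hM]
      have : (4 * C * W / S.a + 1) * S.a / 4 = C * W + S.a / 4 := by field_simp
      rw [this]; linarith
    calc C * (k * W) * ∫ r in (-S.τ c z)..0, Real.exp (M * (z.1 + S.a * r))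
        ≤ C * (k * W) * (Real.exp (M * z.1) / (M * S.a)) := by gcongr
      _ = C * W * (k * (Real.exp (M * z.1) / (M * S.a))) := by ring
      _ ≤ M * S.a / 4 * (k * (Real.exp (M * z.1) / (M * S.a))) := by gcongr
      _ = k / 4 * (1 * Real.exp (M * z.1)) := by field_simp
      _ ≤ k / 4 * (S.ω c * Real.exp (M * z.1)) := by
          have := S.one_le_ω c
          gcongr
  calc _ = |(S.bdry v c z - S.bdry v' c z) + ((∫ r in (-S.τ c z)..0, S.F v c (S.flow c z r)) -
      ∫ r in (-S.τ c z)..0, S.F v' c (S.flow c z r))| := by ring_nf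
    _ ≤ _ := abs_add_le _ _
    _ ≤ k / 2 * (S.ω c * Real.exp (M * z.1)) := by linarith

theorem exists_solution : ∃ v ∈ boundedFamilies S.D, S.op v = v := by
  obtain ⟨M, hM, hcontr⟩ := S.exists_contraction
  obtain ⟨b, hb, hb'⟩ := (S.op_mem S.zero_mem).2.2
  refine exists_fixedPoint_of_weighted_contraction (boundedFamilies S.D) (S.weight M) S.op
    (fun u hu => S.op_mem hu) hcontr 0 S.zero_mem b hb (fun c z => ?_) fun u l hu h0 hl => ?_
  · by_cases hz : z ∈ S.D c
    · simpa using (hb' c z).trans (le_mul_of_one_le_right hb (S.one_le_weight hM.le hz))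
    · rw [S.op_of_notMem 0 hz, S.weight_of_notMem M hz]; simp
  · refine ⟨fun c => measurable_of_tendsto_metrizable (fun k => (hu k).1 c)
      (tendsto_pi_nhds.2 fun z => hl c z), fun c z hz => ?_, ?_⟩
    · refine tendsto_nhds_unique (hl c z) ?_
      simp only [(hu _).2.1 c z hz]
      exact tendsto_const_nhds
    · obtain ⟨b₁, hb₁, h1⟩ := (hu 0).2.2
      have hω : 0 ≤ ∑ c, S.ω c := Finset.sum_nonneg fun c _ => zero_le_one.trans (S.one_le_ω c)
      -- The limit is within `2 * b * weight` of the first iterate, and the weight is at most `(∑ ω)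
      -- * exp M` because abscissae do not exceed `1`.
      refine ⟨b₁ + 2 * b * ((∑ c, S.ω c) * Real.exp M), by positivity, fun c z => ?_⟩
      have h2 : S.weight M c z ≤ (∑ c, S.ω c) * Real.exp M := by
        by_cases hz : z ∈ S.D c
        · refine (S.weight_le c z).trans ?_
          have := (S.fst_mem c z hz).2
          gcongr
          nlinarith
        · rw [S.weight_of_notMem M hz]; positivity
      have h3 := h0 c z
      have h4 : 2 * b * S.weight M c z ≤ 2 * b * ((∑ c, S.ω c) * Real.exp M) := by gcongr
      have h5 := abs_sub_abs_le_abs_sub (l c z) (u 0 c z)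
      rw [abs_sub_comm] at h5
      linarith [h1 c z]

/-- Iterating the contraction drives the weighted difference to zero. Points where `v'` already
agrees with `v` need no equation; this alternative serves the jump lines, where an arbitrary
solution need not satisfy the integrated equation. -/
theorem eq_of_op_eq {v v' : ι → ℝ × ℝ → ℝ} (hv : v ∈ boundedFamilies S.D)
    (hv' : v' ∈ boundedFamilies S.D) (h : S.op v = v)
    (h' : ∀ c, ∀ z ∈ S.D c, S.op v' c z = v' c z ∨ v' c z = v c z) : v' = v := by
  obtain ⟨M, hM, hcontr⟩ := S.exists_contraction
  obtain ⟨b, hb, hvb⟩ := hv.2.2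
  obtain ⟨b', hb', hvb'⟩ := hv'.2.2
  have key : ∀ k : ℕ, ∀ c z, |v' c z - v c z| ≤ (b + b') * (1 / 2) ^ k * S.weight M c z := by
    intro k
    induction k with
    | zero =>
      intro c z
      by_cases hz : z ∈ S.D c
      · have h1 := hvb c z
        have h2 := hvb' c z
        have h3 := S.one_le_weight hM.le hz
        have h4 := abs_sub (v' c z) (v c z)
        rw [pow_zero, mul_one]
        refine le_trans ?_ (le_mul_of_one_le_right (by positivity) h3)
        linarith
      · rw [hv.2.1 c z hz, hv'.2.1 c z hz, S.weight_of_notMem M hz]; simp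
    | succ k ih =>
      intro c z
      by_cases hz : z ∈ S.D c
      · have hw := zero_le_one.trans (S.one_le_weight hM.le hz)
        rcases h' c z hz with h1 | h1
        · have h2 := hcontr v' hv' v hv _ (by positivity) ih c z
          rw [h, h1] at h2
          exact h2.trans (le_of_eq (by ring))
        · rw [h1, sub_self, abs_zero]
          positivity
      · rw [hv.2.1 c z hz, hv'.2.1 c z hz, S.weight_of_notMem M hz]; simp
  funext c z
  have hlim : Tendsto (fun k : ℕ => (b + b') * (1 / 2 : ℝ) ^ k * S.weight M c z) atTop (𝓝 0) := by
    have := tendsto_pow_atTop_nhds_zero_of_lt_one (r := (1 / 2 : ℝ)) (by norm_num) (by norm_num)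
    simpa using (this.const_mul (b + b')).mul_const (S.weight M c z)
  have h0 : |v' c z - v c z| ≤ 0 := ge_of_tendsto' hlim fun k => key k c z
  exact sub_eq_zero.1 (abs_nonpos_iff.1 h0)

/-- Along a characteristic segment, a fixed point of `op` is Lipschitz continuous with a.e.
derivative `F v`. -/
theorem lipschitz_of_op_eq {v : ι → ℝ × ℝ → ℝ} (hv : v ∈ boundedFamilies S.D)
    (h : S.op v = v) {c : ι} {z : ℝ × ℝ} {t : ℝ} (ht : 0 ≤ t)
    (hD : ∀ r ∈ Icc 0 t, S.flow c z r ∈ S.D c)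
    (hτ : ∀ r ∈ Icc 0 t, S.τ c (S.flow c z r) = S.τ c z + r) :
    (∃ k, LipschitzOnWith k (fun r => v c (S.flow c z r)) (Icc 0 t)) ∧
    ∀ᵐ s : ℝ, s ∈ Ioo 0 t →
      HasDerivAt (fun r => v c (S.flow c z r)) (S.F v c (S.flow c z s)) s := by
  have hz : z ∈ S.D c := by simpa using hD 0 ⟨le_rfl, ht⟩
  have hτ0 := S.τ_nonneg c z hz
  have hmem : ∀ r ∈ Icc (-S.τ c z) t, S.flow c z r ∈ S.D c := by
    intro r hr
    rcases le_total r 0 with h0 | h0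
    · exact S.segment_mem c z hz r ⟨hr.1, h0⟩
    · exact hD r ⟨h0, hr.2⟩
  have hint : ∀ p ∈ Icc (-S.τ c z) t, ∀ q ∈ Icc (-S.τ c z) t,
      IntervalIntegrable (fun r => S.F v c (S.flow c z r)) volume p q := fun p hp q hq =>
    S.intervalIntegrable_F_flow hv fun r hr => hmem r (uIcc_subset_Icc hp hq hr)
  have hrep : ∀ r ∈ Icc 0 t, v c (S.flow c z r) =
      S.bdry v c z + ∫ s in (-S.τ c z)..r, S.F v c (S.flow c z s) := by
    intro r hr
    -- All points of the segment have the same entrance point, so the boundary term is constant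
    -- along it and only the upper limit of the integral varies.
    have e1 : S.entry c (S.flow c z r) = S.entry c z := by
      rw [entry, hτ r hr, flow_flow, entry]; congr 1; ring
    conv_lhs => rw [← h]
    rw [S.op_of_mem v (hD r hr), bdry, e1, bdry, hτ r hr]
    simp only [flow_flow]
    rw [intervalIntegral.integral_comp_add_left (fun s => S.F v c (S.flow c z s)) r]
    congr 2 <;> ring
  obtain ⟨b, hb, hF⟩ := S.exists_bound_F hv
  constructor
  · refine ⟨⟨b, hb⟩, LipschitzOnWith.of_dist_le_mul fun p hp q hq => ?_⟩
    have hp' : p ∈ Icc (-S.τ c z) t := ⟨by linarith [hp.1], hp.2⟩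
    have hq' : q ∈ Icc (-S.τ c z) t := ⟨by linarith [hq.1], hq.2⟩
    have h0 : -S.τ c z ∈ Icc (-S.τ c z) t := ⟨le_rfl, by linarith⟩
    rw [hrep p hp, hrep q hq, Real.dist_eq, add_sub_add_left_eq_sub,
      intervalIntegral.integral_interval_sub_left (hint _ h0 _ hp') (hint _ h0 _ hq'),
      Real.dist_eq]
    exact intervalIntegral.norm_integral_le_of_norm_le_const (a := q) (b := p) (C := b)
      (f := fun r => S.F v c (S.flow c z r)) fun r hr =>
        hF c _ (hmem r (uIcc_subset_Icc hq' hp' (uIoc_subset_uIcc hr)))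
  · have h0 : -S.τ c z ∈ Icc (-S.τ c z) t := ⟨le_rfl, by linarith⟩
    have h1 : t ∈ Icc (-S.τ c z) t := ⟨by linarith, le_rfl⟩
    have had := (hint _ h0 _ h1).ae_hasDerivAt_integral
    filter_upwards [had] with s hs hst
    have hs' := hs (by rw [uIcc_of_le (by linarith)]; exact ⟨by linarith [hst.1], hst.2.le⟩)
      (-S.τ c z) left_mem_uIcc
    refine (hs'.const_add (S.bdry v c z)).congr_of_eventuallyEq ?_
    filter_upwards [Ioo_mem_nhds hst.1 hst.2] with r hr
    exact hrep r ⟨hr.1.le, hr.2.le⟩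

end CharSystem

end CharacteristicSystem

/-! ### Linear right-hand sides with diagonal traces and memory terms. -/

section LinearRightHandSide

/-- Borel functions on the plane that are bounded on the triangle. -/
def TriBounded (f : ℝ × ℝ → ℝ) : Prop := Measurable f ∧ ∃ b, ∀ z ∈ Tri, |f z| ≤ b

namespace TriBounded

variable {f g : ℝ × ℝ → ℝ}

theorem const (a : ℝ) : TriBounded fun _ => a := ⟨measurable_const, |a|, fun _ _ => le_rfl⟩

theorem neg (hf : TriBounded f) : TriBounded fun z => -f z := by
  obtain ⟨h, b, hb⟩ := hf
  exact ⟨h.neg, b, fun z hz => by simpa using hb z hz⟩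

theorem add (hf : TriBounded f) (hg : TriBounded g) : TriBounded fun z => f z + g z := by
  obtain ⟨h, b, hb⟩ := hf
  obtain ⟨h', b', hb'⟩ := hg
  exact ⟨h.add h', b + b', fun z hz => (abs_add_le _ _).trans (add_le_add (hb z hz) (hb' z hz))⟩

theorem sub (hf : TriBounded f) (hg : TriBounded g) : TriBounded fun z => f z - g z := by
  simpa [sub_eq_add_neg] using hf.add hg.neg

theorem mul (hf : TriBounded f) (hg : TriBounded g) : TriBounded fun z => f z * g z := by
  obtain ⟨h, b, hb⟩ := hf
  obtain ⟨h', b', hb'⟩ := hg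
  refine ⟨h.mul h', b * b', fun z hz => ?_⟩
  rw [abs_mul]
  exact mul_le_mul (hb z hz) (hb' z hz) (abs_nonneg _) ((abs_nonneg _).trans (hb z hz))

theorem sum {κ : Type*} [Fintype κ] {f : κ → ℝ × ℝ → ℝ} (hf : ∀ k, TriBounded (f k)) :
    TriBounded fun z => ∑ k, f k z := by
  choose h b hb using hf
  exact ⟨Finset.measurable_sum _ fun k _ => h k, ∑ k, b k, fun z hz =>
    (Finset.abs_sum_le_sum_abs _ _).trans (Finset.sum_le_sum fun k _ => hb k z hz)⟩

theorem isCompact_Tri : IsCompact Tri := by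
  refine (isCompact_Icc (a := (0 : ℝ)) (b := 1)).prod (isCompact_Icc (a := (0 : ℝ)) (b := 1))
    |>.of_isClosed_subset ?_ ?_
  · exact (isClosed_le continuous_const continuous_snd).inter
      ((isClosed_le continuous_snd continuous_fst).inter
        (isClosed_le continuous_fst continuous_const))
  · rintro ⟨x, y⟩ ⟨h1, h2, h3⟩
    simp only at h1 h2 h3
    exact ⟨⟨h1.trans h2, h3⟩, h1, h2.trans h3⟩

theorem of_continuous (hf : Continuous f) : TriBounded f :=
  ⟨hf.measurable, isCompact_Tri.exists_bound_of_continuousOn hf.continuousOn⟩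

end TriBounded

variable {ι : Type*} [Fintype ι]

/-- The right-hand side of a linear system of partial integro-differential equations on the
triangle, with traces on the diagonal. -/
noncomputable def linearRhs (h : ι → ℝ × ℝ → ℝ) (α γ μ : ι → ι → ℝ × ℝ → ℝ)
    (v : ι → ℝ × ℝ → ℝ) (c : ι) (z : ℝ × ℝ) : ℝ :=
  h c z + ∑ c', α c c' z * v c' z + ∑ c', γ c c' z * v c' (z.1, z.1)
    + ∫ s in z.2..z.1, ∑ c', v c' (z.1, s) * μ c c' (s, z.2)

theorem measurable_linearRhs {h : ι → ℝ × ℝ → ℝ} {α γ μ : ι → ι → ℝ × ℝ → ℝ}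
    (hh : ∀ c, Measurable (h c)) (hα : ∀ c c', Measurable (α c c'))
    (hγ : ∀ c c', Measurable (γ c c')) (hμ : ∀ c c', Measurable (μ c c'))
    {v : ι → ℝ × ℝ → ℝ} (hv : ∀ c, Measurable (v c)) (c : ι) :
    Measurable (linearRhs h α γ μ v c) := by
  unfold linearRhs
  refine (((hh c).add (Finset.measurable_sum _ fun c' _ => (hα c c').mul (hv c'))).add
    (Finset.measurable_sum _ fun c' _ => (hγ c c').mul ?_)).add ?_
  · exact (hv c').comp (measurable_fst.prodMk measurable_fst)
  · refine measurable_intervalIntegral_param measurable_snd measurable_fst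
      (f := fun z s => ∑ c', v c' (z.1, s) * μ c c' (s, z.2)) ?_
    refine Finset.measurable_sum _ fun c' _ => Measurable.mul ?_ ?_
    · exact (hv c').comp ((measurable_fst.comp measurable_fst).prodMk measurable_snd)
    · exact (hμ c c').comp (measurable_snd.prodMk (measurable_snd.comp measurable_fst))

theorem mem_Tri_of_mem_uIcc {z : ℝ × ℝ} (hz : z ∈ Tri) {s : ℝ} (hs : s ∈ uIcc z.2 z.1) :
    (s, z.2) ∈ Tri ∧ (z.1, s) ∈ Tri := by
  obtain ⟨h1, h2, h3⟩ := hz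
  rw [uIcc_of_le h2] at hs
  exact ⟨⟨h1, hs.1, hs.2.trans h3⟩, h1.trans hs.1, hs.2, h3⟩

theorem intervalIntegrable_mul_coeff {f g : ℝ × ℝ → ℝ} (hf : TriBounded f) (hg : TriBounded g)
    {z : ℝ × ℝ} (hz : z ∈ Tri) :
    IntervalIntegrable (fun s => f (z.1, s) * g (s, z.2)) volume z.2 z.1 := by
  obtain ⟨hf, b, hb⟩ := hf
  obtain ⟨hg, b', hb'⟩ := hg
  refine intervalIntegrable_of_bounded (b := b * b') ?_ fun s hs => ?_
  · exact (hf.comp measurable_prodMk_left).mul (hg.comp measurable_prodMk_right)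
  · have hm := mem_Tri_of_mem_uIcc hz hs
    rw [abs_mul]
    exact mul_le_mul (hb _ hm.2) (hb' _ hm.1) (abs_nonneg _) ((abs_nonneg _).trans (hb _ hm.2))

/-- The local value, the diagonal trace and the memory integral all use only points on one vertical
slice, the integral over a length at most `1`. A bound for the difference on that slice therefore
controls all three. -/
theorem lipschitz_linearRhs (h : ι → ℝ × ℝ → ℝ) {α γ μ : ι → ι → ℝ × ℝ → ℝ}
    (hα : ∀ c c', TriBounded (α c c')) (hγ : ∀ c c', TriBounded (γ c c'))
    (hμ : ∀ c c', TriBounded (μ c c')) :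
    ∃ C, 0 ≤ C ∧ ∀ v v' : ι → ℝ × ℝ → ℝ, (∀ c, TriBounded (v c)) → (∀ c, TriBounded (v' c)) →
      ∀ c, ∀ z ∈ Tri, ∀ δ : ℝ, 0 ≤ δ → (∀ c' y, |v c' (z.1, y) - v' c' (z.1, y)| ≤ δ) →
        |linearRhs h α γ μ v c z - linearRhs h α γ μ v' c z| ≤ C * δ := by
  obtain ⟨A, hA, hαb⟩ := exists_uniform_bound (f := fun k : ι × ι => α k.1 k.2)
    fun k => (hα k.1 k.2).2
  obtain ⟨G, hG, hγb⟩ := exists_uniform_bound (f := fun k : ι × ι => γ k.1 k.2)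
    fun k => (hγ k.1 k.2).2
  obtain ⟨B, hB, hμb⟩ := exists_uniform_bound (f := fun k : ι × ι => μ k.1 k.2)
    fun k => (hμ k.1 k.2).2
  refine ⟨Fintype.card ι * (A + G + B), by positivity, fun v v' hv hv' c z hz δ hδ hvv => ?_⟩
  have hsum : ∀ {b : ℝ} {p q : ι → ℝ}, (∀ c', |p c'| ≤ b) → (∀ c', |q c'| ≤ δ) →
      |∑ c', p c' * q c'| ≤ Fintype.card ι * (b * δ) := by
    intro b p q hp hq
    calc |∑ c', p c' * q c'| ≤ ∑ c', |p c' * q c'| := Finset.abs_sum_le_sum_abs _ _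
      _ ≤ ∑ _c' : ι, b * δ := by
          refine Finset.sum_le_sum fun c' _ => ?_
          rw [abs_mul]
          exact mul_le_mul (hp c') (hq c') (abs_nonneg _) ((abs_nonneg _).trans (hp c'))
      _ = Fintype.card ι * (b * δ) := by simp
  have hint : ∀ v : ι → ℝ × ℝ → ℝ, (∀ c, TriBounded (v c)) → IntervalIntegrable
      (fun s => ∑ c', v c' (z.1, s) * μ c c' (s, z.2)) volume z.2 z.1 := fun v hv =>
    (IntervalIntegrable.sum Finset.univ fun c' _ =>
      intervalIntegrable_mul_coeff (hv c') (hμ c c') hz).congr fun s _ => by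
        simp
  have e : linearRhs h α γ μ v c z - linearRhs h α γ μ v' c z =
      ∑ c', α c c' z * (v c' z - v' c' z) + ∑ c', γ c c' z * (v c' (z.1, z.1) - v' c' (z.1, z.1))
      + ∫ s in z.2..z.1, ∑ c', μ c c' (s, z.2) * (v c' (z.1, s) - v' c' (z.1, s)) := by
    have : (fun s => ∑ c', μ c c' (s, z.2) * (v c' (z.1, s) - v' c' (z.1, s))) =
        fun s => ∑ c', v c' (z.1, s) * μ c c' (s, z.2) -
          ∑ c', v' c' (z.1, s) * μ c c' (s, z.2) := by
      funext s
      rw [← Finset.sum_sub_distrib]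
      exact Finset.sum_congr rfl fun c' _ => by ring
    rw [this, intervalIntegral.integral_sub (hint v hv) (hint v' hv')]
    simp only [linearRhs, mul_sub, Finset.sum_sub_distrib]
    ring
  rw [e]
  have h1 := hsum (p := fun c' => α c c' z) (fun c' => hαb (c, c') z hz) (fun c' => hvv c' z.2)
  have h2 := hsum (p := fun c' => γ c c' z) (fun c' => hγb (c, c') z hz) (fun c' => hvv c' z.1)
  have h3 : |∫ s in z.2..z.1, ∑ c', μ c c' (s, z.2) * (v c' (z.1, s) - v' c' (z.1, s))| ≤
      Fintype.card ι * (B * δ) := by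
    rw [← Real.norm_eq_abs]
    refine (intervalIntegral.norm_integral_le_of_norm_le_const
      (C := Fintype.card ι * (B * δ)) fun s hs => ?_).trans ?_
    · exact hsum (fun c' => hμb (c, c') _ (mem_Tri_of_mem_uIcc hz (uIoc_subset_uIcc hs)).1)
        (fun c' => hvv c' s)
    · refine mul_le_of_le_one_right (by positivity) ?_
      obtain ⟨h1, h2, h3⟩ := hz
      rw [abs_of_nonneg (by linarith)]
      linarith
  refine (abs_add_three _ _ _).trans ((add_le_add (add_le_add h1 h2) h3).trans (le_of_eq ?_))
  ring

theorem bounded_linearRhs_zero {h : ι → ℝ × ℝ → ℝ} (hh : ∀ c, TriBounded (h c))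
    (α γ μ : ι → ι → ℝ × ℝ → ℝ) :
    ∃ b, 0 ≤ b ∧ ∀ c, ∀ z ∈ Tri, |linearRhs h α γ μ 0 c z| ≤ b := by
  obtain ⟨b, hb, h'⟩ := exists_uniform_bound fun c => (hh c).2
  exact ⟨b, hb, fun c z hz => by simpa [linearRhs] using h' c z hz⟩

end LinearRightHandSide

/-! ### The transformed coefficients. -/

namespace Plant

section Coefficients

variable {n m : ℕ} (P : Plant n m)

theorem continuous_cA : Continuous P.cA :=
  continuous_pi fun i => continuous_pi fun j =>
    continuous_iff_continuousAt.2 fun x => (P.hasDerivAt_cA x i j).continuousAt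

theorem continuous_cAinv : Continuous P.cAinv := P.continuous_cA.comp continuous_neg

theorem continuous_bLmm : Continuous P.bLmm :=
  (P.continuous_cA.matrix_mul continuous_const).matrix_mul P.continuous_cAinv

theorem continuous_bLpm : Continuous P.bLpm := continuous_const.matrix_mul P.continuous_cAinv

theorem continuous_bLmp : Continuous P.bLmp := P.continuous_cA.matrix_mul continuous_const

theorem continuous_bPm : Continuous P.bPm := P.continuous_cA.matrix_mul continuous_const

theorem continuous_bFpm : Continuous P.bFpm := continuous_const.matrix_mul P.continuous_cAinv

theorem continuous_bFmp : Continuous P.bFmp := P.continuous_cA.matrix_mul continuous_const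

theorem continuous_bFmm : Continuous fun z : ℝ × ℝ => P.bFmm z.1 z.2 :=
  ((P.continuous_cA.comp continuous_fst).matrix_mul continuous_const).matrix_mul
    (P.continuous_cAinv.comp continuous_snd)

/-- `Σ⁻` is scalar on each isotachic block, and `gen` has entries only inside blocks. -/
theorem commute_Sm_gen : Commute P.Sm P.gen := by
  ext i j
  simp only [Sm, gen, Lblk, Matrix.diagonal_mul, Matrix.mul_diagonal, Matrix.of_apply]
  split_ifs with h
  · rw [h, mul_comm]
  · simp

theorem commute_Sm_cA (x : ℝ) : Commute P.Sm (P.cA x) :=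
  (P.commute_Sm_gen.smul_right x).exp_right

/-- A matrix commuting with the diagonal matrix `Σ⁻` can have nonzero entries only between equal
speeds. -/
theorem cA_eq_zero (x : ℝ) {i j : Fin n} (h : P.sm i ≠ P.sm j) : P.cA x i j = 0 := by
  have h1 := congrFun (congrFun (P.commute_Sm_cA x).eq i) j
  simp only [Sm, Matrix.diagonal_mul, Matrix.mul_diagonal] at h1
  have h2 : (P.sm i - P.sm j) * P.cA x i j = 0 := by rw [sub_mul, h1]; ring
  exact (mul_eq_zero.1 h2).resolve_left (sub_ne_zero.2 h)

/-- After the block transformation there is no coupling inside the isotachic blocks. -/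
theorem bLmm_eq_zero (x : ℝ) {i j : Fin n} (h : P.sm i = P.sm j) : P.bLmm x i j = 0 := by
  rw [bLmm, Matrix.mul_apply]
  refine Finset.sum_eq_zero fun l _ => ?_
  by_cases hl : P.sm l = P.sm j
  · rw [Matrix.mul_apply, Finset.sum_eq_zero, zero_mul]
    intro k _
    by_cases hk : P.sm i = P.sm k
    · rw [Matrix.sub_apply, Lblk, Matrix.of_apply, if_pos (hk.symm.trans (h.trans hl.symm)),
        sub_self, mul_zero]
    · rw [P.cA_eq_zero x hk, zero_mul]
  · have : P.cAinv x l j = 0 := P.cA_eq_zero (-x) hl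
    rw [this, mul_zero]

end Coefficients

/-- The unknowns of one row of the kernel equations: the entries of `K`, of `L` and of `Φ`. -/
abbrev RowIndex (n m : ℕ) := Fin n ⊕ Fin m ⊕ Fin m

/-! ### Splitting the kernel equations into linear systems, one for each row. -/

section Rows

variable {n m : ℕ}

/-- The kernel `K` with the given rows. -/
def rowsK (U : Fin n → RowIndex n m → ℝ × ℝ → ℝ) (x y : ℝ) : Matrix (Fin n) (Fin n) ℝ :=
  Matrix.of fun i j => U i (.inl j) (x, y)

/-- The kernel `L` with the given rows. -/
def rowsL (U : Fin n → RowIndex n m → ℝ × ℝ → ℝ) (x y : ℝ) : Matrix (Fin n) (Fin m) ℝ :=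
  Matrix.of fun i j => U i (.inr (.inl j)) (x, y)

/-- The function `Φ` with the given rows; it is stored on the edge `y = 0`. -/
def rowsPhi (U : Fin n → RowIndex n m → ℝ × ℝ → ℝ) (x : ℝ) : Matrix (Fin n) (Fin m) ℝ :=
  Matrix.of fun i j => U i (.inr (.inr j)) (x, 0)

variable (P : Plant n m)

/-- The right-hand sides of the kernel equations for one row. -/
noncomputable def rowRhs (K : ℝ → ℝ → Matrix (Fin n) (Fin n) ℝ)
    (L : ℝ → ℝ → Matrix (Fin n) (Fin m) ℝ) (Phi : ℝ → Matrix (Fin n) (Fin m) ℝ) (i : Fin n) :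
    RowIndex n m → ℝ × ℝ → ℝ
  | .inl j => fun z => P.rhsK K L z.1 z.2 i j
  | .inr (.inl j) => fun z => P.rhsL K L z.1 z.2 i j
  | .inr (.inr j) => fun z => P.rhsPhi K L Phi z.1 i j

/-- The domains of the unknowns. -/
def rowDomain : RowIndex n m → Set (ℝ × ℝ)
  | .inl _ => Tri
  | .inr (.inl _) => Tri
  | .inr (.inr _) => {z | 0 ≤ z.1 ∧ z.1 ≤ 1 ∧ z.2 = 0}

/-- The coefficients of the local terms. -/
noncomputable def rowCoupling : RowIndex n m → RowIndex n m → ℝ × ℝ → ℝ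
  | .inl j, .inl k => fun z => P.bLmm z.2 k j
  | .inl j, .inr (.inl k) => fun z => -P.bLpm z.2 k j
  | .inl _, .inr (.inr _) => fun _ => 0
  | .inr (.inl j), .inl k => fun z => P.bLmp z.2 k j
  | .inr (.inl j), .inr (.inl k) => fun _ => P.Lpp k j
  | .inr (.inl _), .inr (.inr _) => fun _ => 0
  | .inr (.inr _), .inl _ => fun _ => 0
  | .inr (.inr j), .inr (.inl k) => fun _ => -(P.Sp * P.D) k j
  | .inr (.inr j), .inr (.inr k) => fun _ => P.A k j

/-- The coefficients of the integral terms. -/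
noncomputable def rowMemory : RowIndex n m → RowIndex n m → ℝ × ℝ → ℝ
  | .inl j, .inl k => fun z => P.bFmm z.1 z.2 k j
  | .inl j, .inr (.inl k) => fun z => P.bFpm z.2 k j
  | .inr (.inl j), .inl k => fun z => P.bFmp z.1 k j
  | .inr (.inl j), .inr (.inl k) => fun _ => P.Fpp k j
  | .inr (.inr j), .inl k => fun z => P.bPm z.1 k j
  | .inr (.inr j), .inr (.inl k) => fun _ => P.Pp k j
  | _, .inr (.inr _) => fun _ => 0

/-- The inhomogeneous terms that do not depend on the other rows. -/
noncomputable def rowFree (i : Fin n) : RowIndex n m → ℝ × ℝ → ℝ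
  | .inl j => fun z => P.bFmm z.1 z.2 i j
  | .inr (.inl j) => fun z => P.bFmp z.1 i j
  | .inr (.inr j) => fun z => P.bPm z.1 i j

/-- The coefficients of the traces on the diagonal in the `i`-th row, which come from `Ω`. -/
noncomputable def rowTrace (U : Fin n → RowIndex n m → ℝ × ℝ → ℝ) (i : Fin n)
    (c : RowIndex n m) : RowIndex n m → ℝ × ℝ → ℝ
  | .inl k => fun z => if k < i then -((P.sm i - P.sm k) * U k c z) else 0
  | .inr _ => fun _ => 0

/-- The inhomogeneous terms of the `i`-th row. -/
noncomputable def rowSource (U : Fin n → RowIndex n m → ℝ × ℝ → ℝ) (i : Fin n)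
    (c : RowIndex n m) (z : ℝ × ℝ) : ℝ :=
  -P.rowFree i c z + ∑ k, if k < i then -(P.bLmm z.1 i k * U k c z) else 0

theorem rowTrace_congr {U U' : Fin n → RowIndex n m → ℝ × ℝ → ℝ} {i : Fin n}
    (h : ∀ k < i, U k = U' k) : P.rowTrace U i = P.rowTrace U' i := by
  funext c c' z
  rcases c' with k | k
  · by_cases hk : k < i
    · simp [rowTrace, h k hk]
    · simp [rowTrace, hk]
  · rfl

theorem rowSource_congr {U U' : Fin n → RowIndex n m → ℝ × ℝ → ℝ} {i : Fin n}
    (h : ∀ k < i, U k = U' k) : P.rowSource U i = P.rowSource U' i := by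
  funext c z
  simp only [rowSource]
  congr 1
  refine Finset.sum_congr rfl fun k _ => ?_
  by_cases hk : k < i
  · simp [h k hk]
  · simp [hk]

theorem triBounded_rowCoupling (c c' : RowIndex n m) : TriBounded (P.rowCoupling c c') := by
  have h1 := P.continuous_bLmm
  have h2 := P.continuous_bLpm
  have h3 := P.continuous_bLmp
  rcases c with j | j | j <;> rcases c' with k | k | k <;>
    refine TriBounded.of_continuous ?_ <;> simp only [rowCoupling] <;> try exact continuous_const
  · exact (h1.comp continuous_snd).matrix_elem k j
  · exact ((h2.comp continuous_snd).matrix_elem k j).neg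
  · exact (h3.comp continuous_snd).matrix_elem k j

theorem triBounded_rowMemory (c c' : RowIndex n m) : TriBounded (P.rowMemory c c') := by
  rcases c with j | j | j <;> rcases c' with k | k | k <;>
    refine TriBounded.of_continuous ?_ <;> simp only [rowMemory] <;> try exact continuous_const
  · exact P.continuous_bFmm.matrix_elem k j
  · exact (P.continuous_bFpm.comp continuous_snd).matrix_elem k j
  · exact (P.continuous_bFmp.comp continuous_fst).matrix_elem k j
  · exact (P.continuous_bPm.comp continuous_fst).matrix_elem k j

theorem triBounded_rowFree (i : Fin n) (c : RowIndex n m) : TriBounded (P.rowFree i c) := by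
  rcases c with j | j | j <;> refine TriBounded.of_continuous ?_ <;> simp only [rowFree]
  · exact P.continuous_bFmm.matrix_elem i j
  · exact (P.continuous_bFmp.comp continuous_fst).matrix_elem i j
  · exact (P.continuous_bPm.comp continuous_fst).matrix_elem i j

variable {U : Fin n → RowIndex n m → ℝ × ℝ → ℝ}

theorem triBounded_rowTrace (hU : ∀ k c, TriBounded (U k c)) (i : Fin n) (c c' : RowIndex n m) :
    TriBounded (P.rowTrace U i c c') := by
  rcases c' with k | k
  · by_cases hk : k < i
    · simpa only [rowTrace, if_pos hk] using ((TriBounded.const _).mul (hU k c)).neg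
    · simpa only [rowTrace, if_neg hk] using TriBounded.const 0
  · exact TriBounded.const 0

theorem triBounded_rowSource (hU : ∀ k c, TriBounded (U k c)) (i : Fin n) (c : RowIndex n m) :
    TriBounded (P.rowSource U i c) := by
  refine (P.triBounded_rowFree i c).neg.add (TriBounded.sum fun k => ?_)
  by_cases hk : k < i
  · simp only [if_pos hk]
    exact ((TriBounded.of_continuous
      ((P.continuous_bLmm.comp continuous_fst).matrix_elem i k)).mul (hU k c)).neg
  · simpa only [if_neg hk] using TriBounded.const 0

/-- This removes the nonlinearity. In `ω_{ik} U_k` the factor `U_k`, `k < i`, belongs to a preceding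
row, so the part of `ω_{ik}` containing `K_{ik}(x,x)` gives a linear trace term in row `i`, and the
part `Λ̄⁻⁻_{ik}` gives a source. -/
theorem sum_Omega (i : Fin n) (c : RowIndex n m) (z : ℝ × ℝ) :
    ∑ k, P.Omega (rowsK U) z.1 i k * U k c z =
      -(∑ k, if k < i then -(P.bLmm z.1 i k * U k c z) else 0)
        - ∑ k, P.rowTrace U i c (.inl k) z * U i (.inl k) (z.1, z.1) := by
  rw [← Finset.sum_neg_distrib, ← Finset.sum_sub_distrib]
  refine Finset.sum_congr rfl fun k _ => ?_
  by_cases hk : k < i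
  · simp only [Omega, Matrix.of_apply, rowTrace, if_pos hk, rowsK]
    ring
  · simp [Omega, rowTrace, hk]

/-- The right-hand side of the `i`-th row of the kernel equations is linear in the `i`-th row. -/
theorem rowRhs_eq_linearRhs (hU : ∀ k c, TriBounded (U k c)) (i : Fin n) (c : RowIndex n m)
    {z : ℝ × ℝ} (hz : z ∈ rowDomain c) :
    P.rowRhs (rowsK U) (rowsL U) (rowsPhi U) i c z =
      linearRhs (P.rowSource U i) P.rowCoupling (P.rowTrace U i) P.rowMemory (U i) c z := by
  have hint : ∀ (c c' : RowIndex n m) (z : ℝ × ℝ), z ∈ Tri → IntervalIntegrable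
      (fun s => U i c' (z.1, s) * P.rowMemory c c' (s, z.2)) volume z.2 z.1 := fun c c' z hz =>
    intervalIntegrable_mul_coeff (hU i c') (P.triBounded_rowMemory c c') hz
  have hsum : ∀ {q : ℕ} (f : Fin q → RowIndex n m) (c : RowIndex n m) (z : ℝ × ℝ), z ∈ Tri →
      IntervalIntegrable (fun s => ∑ k, U i (f k) (z.1, s) * P.rowMemory c (f k) (s, z.2))
        volume z.2 z.1 := fun f c z hz =>
    (IntervalIntegrable.sum Finset.univ fun k _ => hint c (f k) z hz).congr fun s _ => by simp
  have hO := P.sum_Omega (U := U) i c z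
  have hT : ∀ c k, P.rowTrace U i c (.inr k) z = 0 := fun _ _ => rfl
  rcases c with j | j | j
  · have h1 := hsum Sum.inl (.inl j) z hz
    have h2 := hsum (fun k : Fin m => Sum.inr (.inl k)) (.inl j) z hz
    simp only [rowMemory] at h1 h2
    simp only [rowRhs, rhsK, linearRhs, rowSource, rowFree, Matrix.add_apply, Matrix.sub_apply,
      Matrix.mul_apply, Matrix.of_apply, Fintype.sum_sum_type, rowMemory, rowCoupling] at hO ⊢
    simp only [rowsK, rowsL, Matrix.of_apply, mul_zero, zero_mul, Finset.sum_const_zero, add_zero,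
      hT] at hO ⊢
    rw [intervalIntegral.integral_add h1 h2, hO]
    simp only [neg_mul, Finset.sum_neg_distrib, mul_comm (U _ _ _)]
    ring
  · have h1 := hsum Sum.inl (.inr (.inl j)) z hz
    have h2 := hsum (fun k : Fin m => Sum.inr (.inl k)) (.inr (.inl j)) z hz
    simp only [rowMemory] at h1 h2
    simp only [rowRhs, rhsL, linearRhs, rowSource, rowFree, Matrix.add_apply, Matrix.sub_apply,
      Matrix.mul_apply, Matrix.of_apply, Fintype.sum_sum_type, rowMemory, rowCoupling] at hO ⊢
    simp only [rowsK, rowsL, Matrix.of_apply, mul_zero, zero_mul, Finset.sum_const_zero, add_zero,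
      hT] at hO ⊢
    rw [intervalIntegral.integral_add h1 h2, hO]
    simp only [mul_comm (U _ _ _)]
    ring
  -- `Φ` is stored at `y = 0`: the local value of `L` is then `L(x,0)`, and the memory integral runs
  -- over all of `[0,x]`.
  · obtain ⟨x, y⟩ := z
    obtain ⟨-, -, rfl : y = 0⟩ := hz
    simp only [rowRhs, rhsPhi, Matrix.mul_assoc (rowsL U x 0) P.Sp P.D, linearRhs, rowSource,
      rowFree, Matrix.add_apply, Matrix.sub_apply, Matrix.of_apply, Fintype.sum_sum_type,
      rowMemory, rowCoupling]
    rw [Matrix.mul_apply, Matrix.mul_apply, Matrix.mul_apply (M := rowsL U x 0)]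
    simp only [Matrix.mul_apply (M := rowsK U _ _), Matrix.mul_apply (M := rowsL U _ _)]
    simp only [rowsK, rowsL, rowsPhi, Matrix.of_apply, mul_zero, zero_mul, Finset.sum_const_zero,
      add_zero, zero_add, hT] at hO ⊢
    rw [hO]
    simp only [neg_mul, Finset.sum_neg_distrib, mul_comm (U _ _ _)]
    ring

end Rows

end Plant

namespace Plant

/-! ### Geometry of the characteristics, boundary data, and successive solution of the rows. -/

section RowSystem

variable {n m : ℕ} (P : Plant n m)

/-- The speeds in the direction of `y`. -/
def rowSpeed : RowIndex n m → ℝ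
  | .inl j => P.sm j
  | .inr (.inl j) => -P.sp j
  | .inr (.inr _) => 0

/-- The time elapsed on a characteristic of the `i`-th row since its entrance into the domain. -/
noncomputable def rowTime (i : Fin n) : RowIndex n m → ℝ × ℝ → ℝ
  | .inl j => fun z =>
    if P.sm i * z.2 ≤ P.sm j * z.1 then z.2 / P.sm j else (z.1 - z.2) / (P.sm i - P.sm j)
  | .inr (.inl j) => fun z => (z.1 - z.2) / (P.sm i + P.sp j)
  | .inr (.inr _) => fun z => z.1 / P.sm i

/-- The prescribed values at the entrance points, apart from the condition on `y = 0`. -/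
noncomputable def rowData (Phi0 : Matrix (Fin n) (Fin m) ℝ) (i : Fin n) :
    RowIndex n m → ℝ × ℝ → ℝ
  | .inl j => fun z => if z.2 = 0 then 0 else -(P.bLmm z.1 i j / (P.sm i - P.sm j))
  | .inr (.inl j) => fun z => -(P.bLmp z.1 i j / (P.sm i + P.sp j))
  | .inr (.inr j) => fun _ => Phi0 i j

/-- The coefficients of the boundary condition on `y = 0`. -/
noncomputable def rowBottom : RowIndex n m → RowIndex n m → ℝ × ℝ → ℝ
  | .inl j, .inr (.inl k) => fun z => if z.2 = 0 then -((P.Sp * P.C) k j / P.sm j) else 0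
  | .inl j, .inr (.inr k) => fun z => if z.2 = 0 then P.B k j / P.sm j else 0
  | .inl _, .inl _ => fun _ => 0
  | .inr _, _ => fun _ => 0

/-- The weights of the unknowns, which make the boundary condition on `y = 0` contractive. -/
noncomputable def rowWeight : RowIndex n m → ℝ
  | .inl _ => 1 + 4 * ∑ j, ∑ k, (|(P.Sp * P.C) k j / P.sm j| + |P.B k j / P.sm j|)
  | .inr _ => 1

theorem rowDomain_subset (c : RowIndex n m) : rowDomain c ⊆ Tri := by
  rcases c with j | j | j
  · exact subset_rfl
  · exact subset_rfl
  · rintro ⟨x, y⟩ ⟨h1, h2, h3⟩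
    simp only at h1 h2 h3
    subst h3
    exact ⟨le_rfl, h1, h2⟩

theorem measurableSet_Tri : MeasurableSet Tri := TriBounded.isCompact_Tri.measurableSet

theorem measurableSet_rowDomain (c : RowIndex n m) : MeasurableSet (rowDomain c) := by
  rcases c with j | j | j
  · exact measurableSet_Tri
  · exact measurableSet_Tri
  · exact (measurableSet_le measurable_const measurable_fst).inter
      ((measurableSet_le measurable_fst measurable_const).inter
        (measurableSet_eq_fun measurable_snd measurable_const))

theorem rowTime_of_le {i j : Fin n} {z : ℝ × ℝ} (h : P.sm i * z.2 ≤ P.sm j * z.1) :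
    P.rowTime i (.inl j) z = z.2 / P.sm j := if_pos h

theorem rowTime_of_not_le {i j : Fin n} {z : ℝ × ℝ} (h : ¬ P.sm i * z.2 ≤ P.sm j * z.1) :
    P.rowTime i (.inl j) z = (z.1 - z.2) / (P.sm i - P.sm j) := if_neg h

theorem rowTime_nonneg (i : Fin n) (c : RowIndex n m) {z : ℝ × ℝ} (hz : z ∈ rowDomain c) :
    0 ≤ P.rowTime i c z := by
  have hi := P.sm_pos i
  rcases c with j | j | j
  · obtain ⟨h1, h2, h3⟩ := hz
    have hj := P.sm_pos j
    simp only [rowTime]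
    split_ifs with h
    · positivity
    · refine div_nonneg (by linarith) ?_
      push Not at h
      by_contra! h'
      have : P.sm i * z.2 ≤ P.sm j * z.1 := mul_le_mul (by linarith) h2 h1 hj.le
      linarith
  · obtain ⟨h1, h2, h3⟩ := hz
    have hj := P.sp_pos j
    exact div_nonneg (by linarith) (by positivity)
  · obtain ⟨h1, h2, h3⟩ := hz
    exact div_nonneg h1 hi.le

/-- In the triangle `y ≤ x`, so only a characteristic with slope below `1` leaves points above the
line through the corner. This makes the denominator in the second branch of `rowTime` positive. -/
theorem lt_of_mem_above {i j : Fin n} {z : ℝ × ℝ} (hz : z ∈ Tri)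
    (h : P.sm j * z.1 < P.sm i * z.2) : P.sm j < P.sm i := by
  obtain ⟨h1, h2, h3⟩ := hz
  by_contra! h'
  have := mul_le_mul h' h2 h1 (P.sm_pos j).le
  linarith

theorem row_segment_mem (i : Fin n) (c : RowIndex n m) {z : ℝ × ℝ} (hz : z ∈ rowDomain c)
    {r : ℝ} (hr : r ∈ Icc (-P.rowTime i c z) 0) :
    (z.1 + P.sm i * r, z.2 + P.rowSpeed c * r) ∈ rowDomain c := by
  obtain ⟨x, y⟩ := z
  obtain ⟨hr1, hr2⟩ := hr
  have hi := P.sm_pos i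
  rcases c with j | j | j
  · have hz' : (x, y) ∈ Tri := hz
    obtain ⟨h1, h2, h3⟩ := hz
    have hj := P.sm_pos j
    simp only [rowTime, rowSpeed, rowDomain, Tri, mem_ofPred_eq] at *
    split_ifs at hr1 with h
    · have e1 : -y ≤ P.sm j * r := by
        have := mul_le_mul_of_nonneg_left hr1 hj.le
        rwa [mul_neg, mul_div_cancel₀ _ hj.ne'] at this
      refine ⟨by linarith, ?_, by nlinarith⟩
      rcases le_total (P.sm i) (P.sm j) with h' | h'
      · nlinarith
      · have : P.sm j * (y + P.sm j * r) ≤ P.sm j * (x + P.sm i * r) := by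
          nlinarith [mul_nonneg (sub_nonneg.2 h') (by linarith : 0 ≤ y + P.sm j * r)]
        exact le_of_mul_le_mul_left this hj
    · push Not at h
      have hlt := P.lt_of_mem_above (z := (x, y)) hz' h
      have hd : 0 < P.sm i - P.sm j := sub_pos.2 hlt
      have e1 : -(x - y) ≤ (P.sm i - P.sm j) * r := by
        have := mul_le_mul_of_nonneg_left hr1 hd.le
        rwa [mul_neg, mul_div_cancel₀ _ hd.ne'] at this
      refine ⟨?_, by linarith, by nlinarith⟩
      have : 0 ≤ (P.sm i - P.sm j) * (y + P.sm j * r) := by nlinarith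
      exact nonneg_of_mul_nonneg_right this hd
  · obtain ⟨h1, h2, h3⟩ := hz
    have hj := P.sp_pos j
    simp only [rowTime, rowSpeed, rowDomain, Tri, mem_ofPred_eq] at *
    have hd : 0 < P.sm i + P.sp j := by positivity
    have e1 : -(x - y) ≤ (P.sm i + P.sp j) * r := by
      have := mul_le_mul_of_nonneg_left hr1 hd.le
      rwa [mul_neg, mul_div_cancel₀ _ hd.ne'] at this
    exact ⟨by nlinarith, by linarith, by nlinarith⟩
  · obtain ⟨h1, h2, h3⟩ := hz
    simp only [rowTime, rowSpeed, rowDomain, mem_ofPred_eq] at *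
    have e1 : -x ≤ P.sm i * r := by
      have := mul_le_mul_of_nonneg_left hr1 hi.le
      rwa [mul_neg, mul_div_cancel₀ _ hi.ne'] at this
    exact ⟨by linarith, by nlinarith, by linarith⟩

/-- For `K_{ij}`, the quantity `s_i y - s_j x` is constant in the direction `(s_i, s_j)`, so a
characteristic never changes branch in `rowTime`; on each branch the time is affine. -/
theorem rowTime_flow (i : Fin n) (c : RowIndex n m) {z : ℝ × ℝ} {r : ℝ} (hz : z ∈ Tri) :
    P.rowTime i c (z.1 + P.sm i * r, z.2 + P.rowSpeed c * r) = P.rowTime i c z + r := by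
  obtain ⟨x, y⟩ := z
  have hi := P.sm_pos i
  rcases c with j | j | j
  · have hj := P.sm_pos j
    have e : P.sm i * (y + P.sm j * r) ≤ P.sm j * (x + P.sm i * r) ↔
        P.sm i * y ≤ P.sm j * x := by
      constructor <;> intro h <;> nlinarith
    by_cases h : P.sm i * y ≤ P.sm j * x
    · rw [P.rowTime_of_le (z := (x, y)) h, P.rowTime_of_le (e.2 h)]
      simp only [rowSpeed]
      field_simp
    · rw [P.rowTime_of_not_le (z := (x, y)) h, P.rowTime_of_not_le (fun h' => h (e.1 h'))]
      push Not at h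
      have hd : P.sm i - P.sm j ≠ 0 := sub_ne_zero.2 (P.lt_of_mem_above (z := (x, y)) hz h).ne'
      simp only [rowSpeed]
      field_simp
      ring
  · have hj := P.sp_pos j
    have hd : P.sm i + P.sp j ≠ 0 := by positivity
    simp only [rowTime, rowSpeed]
    field_simp
    ring
  · simp only [rowTime]
    field_simp

theorem measurable_rowTime (i : Fin n) (c : RowIndex n m) : Measurable (P.rowTime i c) := by
  rcases c with j | j | j
  · exact Measurable.ite (measurableSet_le (measurable_snd.const_mul _) (measurable_fst.const_mul _))
      (measurable_snd.div_const _) ((measurable_fst.sub measurable_snd).div_const _)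
  · exact (measurable_fst.sub measurable_snd).div_const _
  · exact measurable_fst.div_const _

theorem triBounded_ite {f g : ℝ × ℝ → ℝ} (hf : TriBounded f) (hg : TriBounded g)
    {p : ℝ × ℝ → Prop} [DecidablePred p] (hp : MeasurableSet {z | p z}) :
    TriBounded fun z => if p z then f z else g z := by
  obtain ⟨h, b, hb⟩ := hf
  obtain ⟨h', b', hb'⟩ := hg
  refine ⟨Measurable.ite hp h h', max b b', fun z hz => ?_⟩
  beta_reduce
  split_ifs
  · exact (hb z hz).trans (le_max_left _ _)
  · exact (hb' z hz).trans (le_max_right _ _)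

theorem measurableSet_snd_eq_zero : MeasurableSet {z : ℝ × ℝ | z.2 = 0} :=
  measurableSet_eq_fun measurable_snd measurable_const

theorem triBounded_rowData (Phi0 : Matrix (Fin n) (Fin m) ℝ) (i : Fin n) (c : RowIndex n m) :
    TriBounded (P.rowData Phi0 i c) := by
  rcases c with j | j | j
  · refine triBounded_ite (TriBounded.const 0) (TriBounded.of_continuous ?_)
      measurableSet_snd_eq_zero
    exact (((P.continuous_bLmm.comp continuous_fst).matrix_elem i j).div_const _).neg
  · refine TriBounded.of_continuous ?_
    exact (((P.continuous_bLmp.comp continuous_fst).matrix_elem i j).div_const _).neg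
  · exact TriBounded.const _

theorem measurable_rowBottom (c c' : RowIndex n m) : Measurable (P.rowBottom c c') := by
  rcases c with j | j
  · rcases c' with k | k | k
    · exact measurable_const
    · exact Measurable.ite measurableSet_snd_eq_zero measurable_const measurable_const
    · exact Measurable.ite measurableSet_snd_eq_zero measurable_const measurable_const
  · exact measurable_const

theorem one_le_rowWeight (c : RowIndex n m) : 1 ≤ P.rowWeight c := by
  rcases c with j | j
  · have : 0 ≤ ∑ j, ∑ k, (|(P.Sp * P.C) k j / P.sm j| + |P.B k j / P.sm j|) :=
      Finset.sum_nonneg fun j _ => Finset.sum_nonneg fun k _ => by positivity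
    simp only [rowWeight]
    linarith
  · exact le_rfl

/-- The bottom condition expresses `K` by `L` and `Φ`, whose weights are `1`, never by `K` itself.
The factor `4` in the weight of `K` absorbs the coefficients, with no smallness assumption on them.
-/
theorem sum_rowBottom_le (c : RowIndex n m) (z : ℝ × ℝ) :
    ∑ c', |P.rowBottom c c' z| * P.rowWeight c' ≤ P.rowWeight c / 4 := by
  rcases c with j | j
  · have h1 : ∑ c', |P.rowBottom (.inl j) c' z| * P.rowWeight c' ≤
        ∑ k, (|(P.Sp * P.C) k j / P.sm j| + |P.B k j / P.sm j|) := by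
      simp only [Fintype.sum_sum_type, rowBottom, rowWeight, abs_zero, zero_mul,
        Finset.sum_const_zero, zero_add, mul_one, ← Finset.sum_add_distrib]
      refine Finset.sum_le_sum fun k _ => ?_
      split_ifs
      · rw [abs_neg]
      · simp only [abs_zero, add_zero]; positivity
    have h0 : ∀ j ∈ Finset.univ, 0 ≤ ∑ k, (|(P.Sp * P.C) k j / P.sm j| + |P.B k j / P.sm j|) :=
      fun j _ => Finset.sum_nonneg fun k _ => by positivity
    have h2 := Finset.single_le_sum h0 (Finset.mem_univ j)
    simp only [rowWeight] at h1 h2 ⊢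
    linarith
  · simp [rowBottom, rowWeight]

theorem triBounded_of_mem {v : RowIndex n m → ℝ × ℝ → ℝ} (hv : v ∈ boundedFamilies rowDomain)
    (c : RowIndex n m) : TriBounded (v c) := by
  obtain ⟨b, -, hb⟩ := hv.2.2
  exact ⟨hv.1 c, b, fun z _ => hb c z⟩

/-- The `i`-th row of the kernel equations, with given contributions of the preceding rows. -/
noncomputable def rowSystem (Phi0 : Matrix (Fin n) (Fin m) ℝ) (i : Fin n)
    (h : RowIndex n m → ℝ × ℝ → ℝ) (γ : RowIndex n m → RowIndex n m → ℝ × ℝ → ℝ)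
    (hh : ∀ c, TriBounded (h c)) (hγ : ∀ c c', TriBounded (γ c c')) :
    CharSystem (RowIndex n m) where
  a := P.sm i
  e := P.rowSpeed
  D := rowDomain
  τ := P.rowTime i
  g := P.rowData Phi0 i
  ρ := P.rowBottom
  ω := P.rowWeight
  F := linearRhs h P.rowCoupling γ P.rowMemory
  a_pos := P.sm_pos i
  measurableSet_D := measurableSet_rowDomain
  fst_mem c z hz := by
    obtain ⟨h1, h2, h3⟩ := rowDomain_subset c hz
    exact ⟨h1.trans h2, h3⟩
  measurable_τ := P.measurable_rowTime i
  τ_nonneg c z hz := P.rowTime_nonneg i c hz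
  segment_mem c z hz r hr := P.row_segment_mem i c hz hr
  measurable_g c := (P.triBounded_rowData Phi0 i c).1
  bounded_g := by
    obtain ⟨b, hb, h'⟩ := exists_uniform_bound fun c => (P.triBounded_rowData Phi0 i c).2
    exact ⟨b, hb, fun c z hz => h' c z (rowDomain_subset c hz)⟩
  measurable_ρ := P.measurable_rowBottom
  one_le_ω := P.one_le_rowWeight
  ρ_le c z _ := P.sum_rowBottom_le c z
  measurable_F v hv c := measurable_linearRhs (fun c => (hh c).1)
    (fun c c' => (P.triBounded_rowCoupling c c').1) (fun c c' => (hγ c c').1)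
    (fun c c' => (P.triBounded_rowMemory c c').1) hv c
  bounded_F_zero := by
    obtain ⟨b, hb, h'⟩ := bounded_linearRhs_zero hh P.rowCoupling γ P.rowMemory
    exact ⟨b, hb, fun c z hz => h' c z (rowDomain_subset c hz)⟩
  lipschitz_F := by
    obtain ⟨C, hC, h'⟩ := lipschitz_linearRhs h P.triBounded_rowCoupling hγ P.triBounded_rowMemory
    exact ⟨C, hC, fun v hv v' hv' c z hz => h' v v' (triBounded_of_mem hv) (triBounded_of_mem hv')
      c z (rowDomain_subset c hz)⟩

/-- The `i`-th row of the kernel equations, when the preceding rows are those of `U`. -/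
noncomputable def rowSystemOf (Phi0 : Matrix (Fin n) (Fin m) ℝ)
    (U : Fin n → RowIndex n m → ℝ × ℝ → ℝ) (hU : ∀ k, U k ∈ boundedFamilies rowDomain)
    (i : Fin n) : CharSystem (RowIndex n m) :=
  P.rowSystem Phi0 i (P.rowSource U i) (P.rowTrace U i)
    (P.triBounded_rowSource (fun k => triBounded_of_mem (hU k)) i)
    (P.triBounded_rowTrace (fun k => triBounded_of_mem (hU k)) i)

theorem rowSystemOf_congr (Phi0 : Matrix (Fin n) (Fin m) ℝ)
    {U U' : Fin n → RowIndex n m → ℝ × ℝ → ℝ} (hU : ∀ k, U k ∈ boundedFamilies rowDomain)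
    (hU' : ∀ k, U' k ∈ boundedFamilies rowDomain) {i : Fin n} (h : ∀ k < i, U k = U' k) :
    P.rowSystemOf Phi0 U hU i = P.rowSystemOf Phi0 U' hU' i := by
  unfold rowSystemOf
  congr 1
  · exact P.rowSource_congr h
  · exact P.rowTrace_congr h

/-- All rows of the kernel equations, in integrated form, have a common solution. -/
theorem exists_rows (Phi0 : Matrix (Fin n) (Fin m) ℝ) :
    ∃ (U : Fin n → RowIndex n m → ℝ × ℝ → ℝ) (hU : ∀ k, U k ∈ boundedFamilies rowDomain),
      ∀ i, (P.rowSystemOf Phi0 U hU i).op (U i) = U i := by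
  suffices H : ∀ N : ℕ, ∃ (U : Fin n → RowIndex n m → ℝ × ℝ → ℝ)
      (hU : ∀ k, U k ∈ boundedFamilies rowDomain),
      ∀ i : Fin n, i.val < N → (P.rowSystemOf Phi0 U hU i).op (U i) = U i by
    obtain ⟨U, hU, h⟩ := H n
    exact ⟨U, hU, fun i => h i i.2⟩
  intro N
  induction N with
  | zero =>
    exact ⟨fun _ => 0, fun _ => ⟨fun _ => measurable_const, fun _ _ _ => rfl, 0, le_rfl,
      fun _ _ => by simp⟩, fun i hi => absurd hi (Nat.not_lt_zero _)⟩
  | succ N ih =>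
    obtain ⟨U, hU, h⟩ := ih
    by_cases hN : N < n
    · set i₀ : Fin n := ⟨N, hN⟩ with hi₀
      obtain ⟨v, hv, hvop⟩ := (P.rowSystemOf Phi0 U hU i₀).exists_solution
      have hU' : ∀ k, Function.update U i₀ v k ∈ boundedFamilies rowDomain := by
        intro k
        by_cases hk : k = i₀
        · subst hk; rw [Function.update_self]; exact hv
        · rw [Function.update_of_ne hk]; exact hU k
      refine ⟨Function.update U i₀ v, hU', fun i hi => ?_⟩
      -- Here `i ≤ i₀`, so the replaced row is not among the predecessors of `i`, and the systems
      -- already solved do not change.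
      have hlt : ∀ k < i, U k = Function.update U i₀ v k := by
        intro k hk
        rw [Function.update_of_ne]
        rintro rfl
        have : i₀.val < i.val := hk
        simp only [hi₀] at this
        omega
      rw [← P.rowSystemOf_congr Phi0 hU hU' hlt]
      by_cases hii : i = i₀
      · subst hii; rw [Function.update_self]; exact hvop
      · rw [Function.update_of_ne hii]
        refine h i ?_
        have : i.val ≠ N := fun e => hii (Fin.ext e)
        omega
    · refine ⟨U, hU, fun i _ => h i ?_⟩
      have := i.2
      omega

end RowSystem

end Plant

namespace Plant

/-! ### The integrated solution satisfies the kernel equations. -/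

section Existence

variable {n m : ℕ} (P : Plant n m)

theorem segment_mem_Tri {x y p q t : ℝ} (h0 : (x, y) ∈ Tri) (h1 : (x + p * t, y + q * t) ∈ Tri)
    {r : ℝ} (hr : r ∈ Icc 0 t) : (x + p * r, y + q * r) ∈ Tri := by
  obtain ⟨a1, a2, a3⟩ := h0
  obtain ⟨b1, b2, b3⟩ := h1
  obtain ⟨hr0, hrt⟩ := hr
  simp only at a1 a2 a3 b1 b2 b3
  rcases eq_or_lt_of_le (hr0.trans hrt) with ht | ht
  · have : r = 0 := le_antisymm (by linarith) hr0
    subst this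
    exact ⟨by simpa using a1, by simpa using a2, by simpa using a3⟩
  · have hs : 0 ≤ t - r := by linarith
    refine ⟨?_, ?_, ?_⟩ <;> simp only <;> refine le_of_mul_le_mul_left ?_ ht
    · nlinarith [mul_nonneg hs a1, mul_nonneg hr0 b1]
    · nlinarith [mul_le_mul_of_nonneg_left a2 hs, mul_le_mul_of_nonneg_left b2 hr0]
    · nlinarith [mul_le_mul_of_nonneg_left a3 hs, mul_le_mul_of_nonneg_left b3 hr0]

theorem Sm_mul_add_mul_Sp (M : Matrix (Fin n) (Fin m) ℝ) (i : Fin n) (j : Fin m) :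
    (P.Sm * M + M * P.Sp) i j = (P.sm i + P.sp j) * M i j := by
  simp only [Sm, Sp, Matrix.add_apply, Matrix.diagonal_mul, Matrix.mul_diagonal]
  ring

theorem Sm_mul_sub_mul_Sm (M : Matrix (Fin n) (Fin n) ℝ) (i j : Fin n) :
    (P.Sm * M - M * P.Sm) i j = (P.sm i - P.sm j) * M i j := by
  simp only [Sm, Matrix.sub_apply, Matrix.diagonal_mul, Matrix.mul_diagonal]
  ring

/-- The boundary condition on `y = 0`, solved for `K`. -/
theorem bottom_iff (V : RowIndex n m → ℝ × ℝ → ℝ) (K : Matrix (Fin n) (Fin n) ℝ)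
    (L Phi : Matrix (Fin n) (Fin m) ℝ) (i j : Fin n) (x : ℝ)
    (hL : ∀ k, V (.inr (.inl k)) (x, 0) = L i k)
    (hPhi : ∀ k, V (.inr (.inr k)) (x, 0) = Phi i k) :
    (K * P.Sm + L * P.Sp * P.C) i j = (Phi * P.B) i j ↔
      K i j = ∑ c', P.rowBottom (.inl j) c' (x, 0) * V c' (x, 0) := by
  have hj := P.sm_pos j
  have e : ∑ c', P.rowBottom (.inl j) c' (x, 0) * V c' (x, 0) =
      ((Phi * P.B) i j - (L * P.Sp * P.C) i j) / P.sm j := by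
    simp only [Fintype.sum_sum_type, rowBottom, hL, hPhi, if_true, zero_mul,
      Finset.sum_const_zero, zero_add, Matrix.mul_assoc L, Matrix.mul_apply (M := L),
      Matrix.mul_apply (M := Phi), sub_div, Finset.sum_div]
    rw [add_comm, ← sub_neg_eq_add, ← Finset.sum_neg_distrib]
    congr 1 <;> refine Finset.sum_congr rfl fun k _ => by ring
  rw [e, eq_div_iff hj.ne', Matrix.add_apply]
  simp only [Sm, Matrix.mul_diagonal]
  exact eq_sub_iff_add_eq.symm

/-- Scaling preserves null sets. For `Φ` this converts almost every characteristic time into almost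
every abscissa. -/
theorem ae_comp_div {p : ℝ → Prop} {a : ℝ} (ha : a ≠ 0) (h : ∀ᵐ s : ℝ, p s) :
    ∀ᵐ x : ℝ, p (x / a) := by
  rw [ae_iff] at h ⊢
  have := Real.volume_preimage_mul_left (inv_ne_zero ha) {s | ¬ p s}
  rw [h, mul_zero] at this
  convert this using 2
  ext x
  simp [div_eq_inv_mul]

variable {P} {Phi0 : Matrix (Fin n) (Fin m) ℝ} {U : Fin n → RowIndex n m → ℝ × ℝ → ℝ}
  {hU : ∀ k, U k ∈ boundedFamilies rowDomain}

/-- At an entrance point the integral is over a degenerate interval, so the fixed-point equation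
reduces to the boundary data. The boundary and initial conditions are read off from this. -/
theorem rows_eq_of_rowTime_eq_zero (h : ∀ i, (P.rowSystemOf Phi0 U hU i).op (U i) = U i)
    {i : Fin n} {c : RowIndex n m} {z : ℝ × ℝ} (hz : z ∈ rowDomain c)
    (hτ : P.rowTime i c z = 0) :
    U i c z = P.rowData Phi0 i c z + ∑ c', P.rowBottom c c' z * U i c' z := by
  have h1 := congrFun (congrFun (h i) c) z
  have hτ' : (P.rowSystemOf Phi0 U hU i).τ c z = 0 := hτ
  rw [CharSystem.op_of_mem _ _ hz, hτ', neg_zero, intervalIntegral.integral_same, add_zero,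
    CharSystem.bdry, CharSystem.entry, hτ', neg_zero, CharSystem.flow_zero] at h1
  exact h1.symm

theorem rows_along_characteristic (h : ∀ i, (P.rowSystemOf Phi0 U hU i).op (U i) = U i)
    (i : Fin n) (c : RowIndex n m) {x y t : ℝ} (ht : 0 ≤ t)
    (hD : ∀ r ∈ Icc 0 t, (x + P.sm i * r, y + P.rowSpeed c * r) ∈ rowDomain c) :
    (∃ k, LipschitzOnWith k (fun r => U i c (x + P.sm i * r, y + P.rowSpeed c * r)) (Icc 0 t)) ∧
    ∀ᵐ s : ℝ, s ∈ Ioo 0 t →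
      HasDerivAt (fun r => U i c (x + P.sm i * r, y + P.rowSpeed c * r))
        (P.rowRhs (rowsK U) (rowsL U) (rowsPhi U) i c (x + P.sm i * s, y + P.rowSpeed c * s))
        s := by
  have hz : (x, y) ∈ Tri := rowDomain_subset c (by simpa using hD 0 ⟨le_rfl, ht⟩)
  obtain ⟨h1, h2⟩ := (P.rowSystemOf Phi0 U hU i).lipschitz_of_op_eq (hU i) (h i) (c := c)
    (z := (x, y)) ht hD (fun r _ => P.rowTime_flow i c hz)
  refine ⟨h1, ?_⟩
  filter_upwards [h2] with s hs hst
  rw [P.rowRhs_eq_linearRhs (fun k => triBounded_of_mem (hU k)) i c (hD s ⟨hst.1.le, hst.2.le⟩)]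
  exact hs hst

theorem absolutelyContinuous_of_lipschitz {f : ℝ → ℝ} {t : ℝ} (ht : 0 ≤ t)
    (h : ∃ k, LipschitzOnWith k f (Icc 0 t)) : AbsolutelyContinuousOnInterval f 0 t := by
  obtain ⟨k, hk⟩ := h
  rw [← uIcc_of_le ht] at hk
  exact hk.absolutelyContinuousOnInterval

theorem isBoundedKernelSolution_rows
    (h : ∀ i, (P.rowSystemOf Phi0 U hU i).op (U i) = U i) :
    P.IsBoundedKernelSolution Phi0 (rowsK U) (rowsL U) (rowsPhi U) := by
  obtain ⟨b, -, hb'⟩ := exists_uniform_bound (κ := Fin n) (s := univ)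
    (f := fun i (q : RowIndex n m × (ℝ × ℝ)) => U i q.1 q.2)
    fun i => by
      obtain ⟨b, -, hb⟩ := (hU i).2.2
      exact ⟨b, fun q _ => hb q.1 q.2⟩
  have hb : ∀ i c z, |U i c z| ≤ b := fun i c z => hb' i (c, z) (mem_univ _)
  have hdiag : ∀ x ∈ Icc (0 : ℝ) 1, (x, x) ∈ Tri := fun x hx => ⟨hx.1, le_rfl, hx.2⟩
  have hedge : ∀ x ∈ Icc (0 : ℝ) 1, (x, (0 : ℝ)) ∈ Tri := fun x hx => ⟨le_rfl, hx.1, hx.2⟩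
  constructor
  case measurable_K => exact fun i j => ((hU i).1 (.inl j)).comp measurable_subtype_coe
  case measurable_L => exact fun i j => ((hU i).1 (.inr (.inl j))).comp measurable_subtype_coe
  case bounded_K => exact ⟨b, fun p _ i j => hb i (.inl j) p⟩
  case bounded_L => exact ⟨b, fun p _ i j => hb i (.inr (.inl j)) p⟩
  case bounded_Phi => exact ⟨b, fun x _ i j => hb i (.inr (.inr j)) (x, 0)⟩
  case eqK =>
    intro i j x y t ht h0 h1 _
    obtain ⟨hl, hd⟩ := rows_along_characteristic h i (.inl j) ht
      (fun r hr => segment_mem_Tri h0 h1 hr)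
    exact ⟨absolutelyContinuous_of_lipschitz ht hl, hd⟩
  case eqL =>
    intro i j x y t ht h0 h1
    simp only [sub_eq_add_neg, ← neg_mul] at h1 ⊢
    obtain ⟨hl, hd⟩ := rows_along_characteristic h i (.inr (.inl j)) ht
      (fun r hr => segment_mem_Tri h0 h1 hr)
    exact ⟨absolutelyContinuous_of_lipschitz ht hl, hd⟩
  case eqPhi =>
    intro i j
    have hi := P.sm_pos i
    -- The single characteristic of `Φ` starts at `(0,0)` and reaches `x = 1` at time `1 / s_i`.
    obtain ⟨⟨k, hl⟩, hd⟩ := rows_along_characteristic h i (.inr (.inr j)) (x := 0) (y := 0)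
      (t := 1 / P.sm i) (by positivity) (fun r hr => by
        obtain ⟨h1, h2⟩ := hr
        rw [le_div_iff₀ hi] at h2
        exact ⟨by simpa using by positivity, by simp only; linarith, by simp [rowSpeed]⟩)
    have e : ∀ r, U i (.inr (.inr j)) (0 + P.sm i * (r / P.sm i),
        0 + P.rowSpeed (.inr (.inr j) : RowIndex n m) * (r / P.sm i)) = rowsPhi U r i j := by
      intro r
      simp only [rowSpeed, rowsPhi, Matrix.of_apply]
      congr 2
      · field_simp; ring
      · ring
    constructor
    · refine absolutelyContinuous_of_lipschitz zero_le_one ⟨k * ⟨1 / P.sm i, by positivity⟩, ?_⟩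
      have hs : LipschitzOnWith ⟨1 / P.sm i, by positivity⟩ (fun r : ℝ => r / P.sm i)
          (Icc 0 1) := by
        refine LipschitzOnWith.of_dist_le_mul fun p _ q _ => le_of_eq ?_
        rw [Real.dist_eq, Real.dist_eq, ← sub_div, abs_div, abs_of_pos hi]
        change _ = 1 / P.sm i * _
        ring
      have := hl.comp hs fun r hr => ⟨div_nonneg hr.1 hi.le, by
        have := hr.2
        gcongr⟩
      simpa only [Function.comp_def, e] using this
    · filter_upwards [ae_comp_div hi.ne' hd] with x hx hx01
      have h1 := hx ⟨div_pos hx01.1 hi, by have := hx01.2; gcongr⟩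
      have h2 := h1.comp x ((hasDerivAt_id x).div_const (P.sm i))
      simp only [Function.comp_def, id, e] at h2
      refine ⟨_, h2, ?_⟩
      rw [mul_comm, mul_assoc, one_div, inv_mul_cancel₀ hi.ne', mul_one]
      change P.rhsPhi _ _ _ (0 + P.sm i * (x / P.sm i)) i j = _
      rw [zero_add, mul_div_cancel₀ _ hi.ne']
  case diagL =>
    intro x hx
    ext i j
    rw [Sm_mul_add_mul_Sp]
    have hs : 0 < P.sm i + P.sp j := add_pos (P.sm_pos i) (P.sp_pos j)
    have h1 := rows_eq_of_rowTime_eq_zero h (i := i) (c := .inr (.inl j)) (hdiag x hx)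
      (by simp [rowTime])
    simp only [rowData, rowBottom, zero_mul, Finset.sum_const_zero, add_zero] at h1
    change (P.sm i + P.sp j) * U i (.inr (.inl j)) (x, x) = _
    rw [h1, Matrix.neg_apply]
    field_simp
  case diagK =>
    intro x hx
    have hxm : x ∈ Icc (0 : ℝ) 1 := ⟨hx.1.le, hx.2⟩
    ext i j
    rw [Sm_mul_sub_mul_Sm, Matrix.add_apply, Matrix.neg_apply, Omega, Matrix.of_apply]
    by_cases hji : j < i
    -- Below the matrix diagonal the condition is the definition of `ω_{ij}`.
    · rw [if_pos hji]; ring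
    · rw [if_neg hji, add_zero]
      rcases eq_or_lt_of_le (P.sm_anti (not_lt.1 hji)) with hs | hs
      -- For equal speeds the left-hand side vanishes; the condition is solvable only because the
      -- block transformation has eliminated this entry.
      · rw [hs, sub_self, zero_mul, P.bLmm_eq_zero x hs.symm, neg_zero]
      · have hd : 0 < P.sm i - P.sm j := sub_pos.2 hs
        have hnot : ¬ P.sm i * x ≤ P.sm j * x := by
          have := hx.1
          push Not
          gcongr
        have h1 := rows_eq_of_rowTime_eq_zero h (i := i) (c := .inl j) (hdiag x hxm)
          (by rw [P.rowTime_of_not_le hnot]; simp)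
        have h2 : ∀ c', P.rowBottom (.inl j) c' (x, x) = 0 := by
          rintro (k | k | k) <;> simp [rowBottom, hx.1.ne']
        simp only [rowData, h2, zero_mul, Finset.sum_const_zero, add_zero, if_neg hx.1.ne'] at h1
        change (P.sm i - P.sm j) * U i (.inl j) (x, x) = _
        rw [h1]
        field_simp
  case bottom =>
    intro i j x hx _
    rw [bottom_iff P (U i) (rowsK U x 0) (rowsL U x 0) (rowsPhi U x) i j x (fun _ => rfl)
      (fun _ => rfl)]
    have h1 := rows_eq_of_rowTime_eq_zero h (i := i) (c := .inl j) (hedge x hx) (by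
      rw [P.rowTime_of_le (by simpa using mul_nonneg (P.sm_pos j).le hx.1)]; simp)
    simpa [rowsK, rowData] using h1
  case init =>
    ext i j
    have h1 := rows_eq_of_rowTime_eq_zero h (i := i) (c := .inr (.inr j)) (z := (0, 0))
      ⟨le_rfl, zero_le_one, rfl⟩ (by simp [rowTime])
    simpa [rowsPhi, rowData, rowBottom] using h1

end Existence

end Plant

namespace Plant

/-! ### The jump lines are negligible. -/

section Uniqueness

variable {n m : ℕ} (P : Plant n m)

/-- The line on which the `(i, j)` entry of `K` may jump. -/
def Jump (i j : Fin n) (z : ℝ × ℝ) : Prop := P.sm j < P.sm i ∧ P.sm i * z.2 = P.sm j * z.1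

theorem ae_mul_ne {p q : ℝ} (h : p = 0 → q ≠ 0) : ∀ᵐ s : ℝ, p * s ≠ q := by
  by_cases hp : p = 0
  · refine Filter.Eventually.of_forall fun s hs => h hp ?_
    rw [← hs, hp, zero_mul]
  · have : ∀ᵐ s : ℝ, s ≠ q / p := by simp [ae_iff, measure_singleton]
    filter_upwards [this] with s hs h'
    exact hs (by rw [← h']; field_simp)

theorem ae_not_jump_vertical (x : ℝ) : ∀ᵐ s : ℝ, ∀ k l, ¬ P.Jump k l (x, s) := by
  refine ae_all_iff.2 fun k => ae_all_iff.2 fun l => ?_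
  filter_upwards [ae_mul_ne (p := P.sm k) (q := P.sm l * x) fun h => absurd h (P.sm_pos k).ne']
    with s hs h
  exact hs h.2

/-- A line meets a jump line in at most one point unless it is contained in it. A characteristic of
`K_{ij}` parallel to the `(k,l)` jump line has the same slope as the `(i,j)` jump line, and both
jump lines pass through the origin; so containment would put `z` on the `(i,j)` jump line.
Characteristics of `L` have negative slope and are never parallel to one. -/
theorem ae_not_jump_flow {i : Fin n} {c : RowIndex n m} {z : ℝ × ℝ}
    (hc : ∀ j, c ≠ .inr (.inr j)) (hz : ∀ j, c = .inl j → ¬ P.Jump i j z) :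
    ∀ᵐ r : ℝ, ∀ k l, ¬ P.Jump k l (z.1 + P.sm i * r, z.2 + P.rowSpeed c * r) := by
  refine ae_all_iff.2 fun k => ae_all_iff.2 fun l => ?_
  by_cases hkl : P.sm l < P.sm k
  swap
  · exact Filter.Eventually.of_forall fun r h => hkl h.1
  have hi := P.sm_pos i
  have hk := P.sm_pos k
  have hl := P.sm_pos l
  have hne : P.sm k * P.rowSpeed c - P.sm l * P.sm i = 0 →
      P.sm l * z.1 - P.sm k * z.2 ≠ 0 := by
    intro h1 h2
    rcases c with j | j | j
    · have hj := P.sm_pos j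
      simp only [rowSpeed] at h1
      refine hz j rfl ⟨?_, ?_⟩
      · by_contra! h3
        nlinarith
      · have h3 : P.sm l * (P.sm i * z.2 - P.sm j * z.1) = 0 := by
          linear_combination (-z.2) * h1 - P.sm j * h2
        exact sub_eq_zero.1 ((mul_eq_zero.1 h3).resolve_left hl.ne')
    · have hj := P.sp_pos j
      simp only [rowSpeed] at h1
      nlinarith [mul_pos hk hj, mul_pos hl hi]
    · exact hc j rfl
  filter_upwards [ae_mul_ne hne] with r hr h
  refine hr ?_
  have := h.2
  simp only at this
  linear_combination this

section Congruence

variable {P} {K K' : ℝ → ℝ → Matrix (Fin n) (Fin n) ℝ} {L L' : ℝ → ℝ → Matrix (Fin n) (Fin m) ℝ}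
  {Phi Phi' : ℝ → Matrix (Fin n) (Fin m) ℝ}

/-- `Ω` uses `K_{ij}` only for `j < i`, where `s_i ≤ s_j` and no jump is allowed; hence the diagonal
traces are unambiguous. -/
theorem Omega_congr (hK : ∀ z ∈ Tri, ∀ i j, ¬ P.Jump i j z → K z.1 z.2 i j = K' z.1 z.2 i j)
    {x : ℝ} (hx : x ∈ Icc (0 : ℝ) 1) : P.Omega K x = P.Omega K' x := by
  ext i j
  simp only [Omega, Matrix.of_apply]
  by_cases hji : j < i
  · rw [if_pos hji, if_pos hji, hK (x, x) ⟨hx.1, le_rfl, hx.2⟩ i j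
      fun h => absurd h.1 (not_lt.2 (P.sm_anti hji.le))]
  · rw [if_neg hji, if_neg hji]

theorem integral_congr_of_ae_entries {q : ℕ} {x y : ℝ} (hz : (x, y) ∈ Tri)
    (hK : ∀ z ∈ Tri, ∀ i j, ¬ P.Jump i j z → K z.1 z.2 i j = K' z.1 z.2 i j)
    (hL : ∀ z ∈ Tri, L z.1 z.2 = L' z.1 z.2)
    (f : Matrix (Fin n) (Fin n) ℝ → Matrix (Fin n) (Fin m) ℝ → ℝ → Matrix (Fin n) (Fin q) ℝ)
    (i : Fin n) (j : Fin q) :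
    ∫ s in y..x, f (K x s) (L x s) s i j = ∫ s in y..x, f (K' x s) (L' x s) s i j := by
  refine intervalIntegral.integral_congr_ae ?_
  filter_upwards [P.ae_not_jump_vertical x] with s hs hmem
  have hm := (mem_Tri_of_mem_uIcc hz (uIoc_subset_uIcc hmem)).2
  have : K x s = K' x s := by
    ext k l
    exact hK (x, s) hm k l (hs k l)
  rw [this, hL (x, s) hm]

/-- The right-hand sides do not depend on the values of `K` on the lines of discontinuity. -/
theorem rowRhs_congr (hK : ∀ z ∈ Tri, ∀ i j, ¬ P.Jump i j z → K z.1 z.2 i j = K' z.1 z.2 i j)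
    (hL : ∀ z ∈ Tri, L z.1 z.2 = L' z.1 z.2) (hPhi : ∀ x ∈ Icc (0 : ℝ) 1, Phi x = Phi' x)
    (i : Fin n) (c : RowIndex n m) {z : ℝ × ℝ} (hz : z ∈ Tri)
    (hJ : (∀ k l, ¬ P.Jump k l z) ∨ ∃ j, c = .inr (.inr j)) :
    P.rowRhs K L Phi i c z = P.rowRhs K' L' Phi' i c z := by
  obtain ⟨x, y⟩ := z
  have hx : x ∈ Icc (0 : ℝ) 1 := ⟨hz.1.trans hz.2.1, hz.2.2⟩
  have hO := Omega_congr hK hx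
  have hLz : L x y = L' x y := hL (x, y) hz
  rcases c with j | j | j
  · have hKz : K x y = K' x y := by
      ext k l
      refine hK (x, y) hz k l ?_
      rcases hJ with h | ⟨_, h⟩
      · exact h k l
      · cases h
    simp only [rowRhs, rhsK, hO, hKz, hLz, Matrix.add_apply, Matrix.of_apply]
    rw [integral_congr_of_ae_entries hz hK hL (fun A _ s => A * P.bFmm s y) i j,
      integral_congr_of_ae_entries hz hK hL (fun _ B s => B * P.bFpm y) i j]
  · have hKz : K x y = K' x y := by
      ext k l
      refine hK (x, y) hz k l ?_
      rcases hJ with h | ⟨_, h⟩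
      · exact h k l
      · cases h
    simp only [rowRhs, rhsL, hO, hKz, hLz, Matrix.add_apply, Matrix.of_apply]
    rw [integral_congr_of_ae_entries hz hK hL (fun A _ s => A * P.bFmp s) i j,
      integral_congr_of_ae_entries hz hK hL (fun _ B s => B * P.Fpp) i j]
  · have h0 : (x, (0 : ℝ)) ∈ Tri := ⟨le_rfl, hx.1, hx.2⟩
    have hL0 : L x 0 = L' x 0 := hL (x, 0) h0
    simp only [rowRhs, rhsPhi, hO, hPhi x hx, hL0, Matrix.add_apply (_ - _), Matrix.of_apply]
    rw [integral_congr_of_ae_entries h0 hK hL (fun A B s => A * P.bPm s + B * P.Pp) i j]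

end Congruence

end Uniqueness

end Plant

namespace Plant

/-! ### Comparison of an arbitrary solution with the constructed one. -/

section Uniqueness

variable {n m : ℕ} (P : Plant n m)

open scoped Classical in
/-- The rows of given kernels, extended by zero, and with the values of `U` on the lines of
discontinuity. -/
noncomputable def regularizedRows (U : Fin n → RowIndex n m → ℝ × ℝ → ℝ)
    (K : ℝ → ℝ → Matrix (Fin n) (Fin n) ℝ) (L : ℝ → ℝ → Matrix (Fin n) (Fin m) ℝ)
    (Phi : ℝ → Matrix (Fin n) (Fin m) ℝ) (i : Fin n) : RowIndex n m → ℝ × ℝ → ℝ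
  | .inl j => fun z => if P.Jump i j z then U i (.inl j) z else
      if z ∈ Tri then K z.1 z.2 i j else 0
  | .inr (.inl j) => fun z => if z ∈ Tri then L z.1 z.2 i j else 0
  | .inr (.inr j) => fun z =>
      if z ∈ rowDomain (.inr (.inr j) : RowIndex n m) then Phi z.1 i j else 0

variable {P} {Phi0 : Matrix (Fin n) (Fin m) ℝ} {U : Fin n → RowIndex n m → ℝ × ℝ → ℝ}
  {K : ℝ → ℝ → Matrix (Fin n) (Fin n) ℝ} {L : ℝ → ℝ → Matrix (Fin n) (Fin m) ℝ}
  {Phi : ℝ → Matrix (Fin n) (Fin m) ℝ}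

theorem measurableSet_jump (i j : Fin n) : MeasurableSet {z | P.Jump i j z} := by
  by_cases h : P.sm j < P.sm i
  · simp only [Jump, h, true_and]
    exact measurableSet_eq_fun (measurable_snd.const_mul _) (measurable_fst.const_mul _)
  · simp [Jump, h]

open scoped Classical in
theorem measurable_extend_Tri {f : ℝ × ℝ → ℝ} (hf : Measurable (Tri.domRestrict f)) :
    Measurable fun z => if z ∈ Tri then f z else 0 :=
  measurable_of_restrict_of_restrict_compl measurableSet_Tri
    (by simpa [Set.domRestrict_def] using hf) (by
      have : Triᶜ.domRestrict (fun z => if z ∈ Tri then f z else 0) = fun _ => 0 := by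
        funext z; exact if_neg z.2
      rw [this]; exact measurable_const)

theorem regularizedRows_mem (hU : ∀ k, U k ∈ boundedFamilies rowDomain)
    (hs : P.IsBoundedKernelSolution Phi0 K L Phi) (i : Fin n) :
    P.regularizedRows U K L Phi i ∈ boundedFamilies rowDomain := by
  obtain ⟨bU, hbU, hU'⟩ := (hU i).2.2
  obtain ⟨bK, hK⟩ := hs.bounded_K
  obtain ⟨bL, hL⟩ := hs.bounded_L
  obtain ⟨bP, hP⟩ := hs.bounded_Phi
  refine ⟨?_, ?_, bU + |bK| + |bL| + |bP|, by positivity, ?_⟩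
  · rintro (j | j | j)
    · exact Measurable.ite (measurableSet_jump i j) ((hU i).1 _)
        (measurable_extend_Tri (hs.measurable_K i j))
    · exact measurable_extend_Tri (hs.measurable_L i j)
    -- Measurability of `Φ` follows from its absolute continuity.
    · have hc : ContinuousOn (fun x => Phi x i j) (Icc 0 1) := by
        have := (hs.eqPhi i j).1.continuousOn
        rwa [uIcc_of_le zero_le_one] at this
      have hm : Measurable ((Icc (0 : ℝ) 1).piecewise (fun x => Phi x i j) fun _ => 0) :=
        hc.measurable_piecewise continuousOn_const measurableSet_Icc
      have he : P.regularizedRows U K L Phi i (.inr (.inr j)) = fun z : ℝ × ℝ =>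
          if z.2 = 0 then (Icc (0 : ℝ) 1).piecewise (fun x => Phi x i j) (fun _ => 0) z.1
          else 0 := by
        funext z
        simp only [regularizedRows, rowDomain, mem_ofPred_eq, Set.piecewise, mem_Icc]
        by_cases h1 : z.2 = 0 <;> by_cases h2 : 0 ≤ z.1 <;> by_cases h3 : z.1 ≤ 1 <;>
          simp [h1, h2, h3]
      rw [he]
      exact Measurable.ite measurableSet_snd_eq_zero (hm.comp measurable_fst) measurable_const
  · rintro (j | j | j) z hz
    · simp only [regularizedRows]
      rw [(hU i).2.1 _ z hz, if_neg (show z ∉ Tri from hz), ite_self]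
    · exact if_neg hz
    · exact if_neg hz
  · have h0 : 0 ≤ bU + |bK| + |bL| + |bP| := by positivity
    have e1 := abs_nonneg bK
    have e2 := abs_nonneg bL
    have e3 := abs_nonneg bP
    rintro (j | j | j) z <;> simp only [regularizedRows]
    · split_ifs with h1 h2
      · linarith [hU' (.inl j) z]
      · linarith [hK z h2 i j, le_abs_self bK]
      · rwa [abs_zero]
    · split_ifs with h2
      · linarith [hL z h2 i j, le_abs_self bL]
      · rwa [abs_zero]
    · split_ifs with h2
      · linarith [hP z.1 ⟨h2.1, h2.2.1⟩ i j, le_abs_self bP]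
      · rwa [abs_zero]

theorem regularizedRows_K {i j : Fin n} {z : ℝ × ℝ} (hz : z ∈ Tri) (hJ : ¬ P.Jump i j z) :
    P.regularizedRows U K L Phi i (.inl j) z = K z.1 z.2 i j := by
  simp only [regularizedRows, if_neg hJ, if_pos hz]

theorem regularizedRows_L {i : Fin n} {j : Fin m} {z : ℝ × ℝ} (hz : z ∈ Tri) :
    P.regularizedRows U K L Phi i (.inr (.inl j)) z = L z.1 z.2 i j := if_pos hz

theorem regularizedRows_Phi {i : Fin n} {j : Fin m} {z : ℝ × ℝ}
    (hz : z ∈ rowDomain (.inr (.inr j) : RowIndex n m)) :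
    P.regularizedRows U K L Phi i (.inr (.inr j)) z = Phi z.1 i j := if_pos hz

/-- Off the lines of discontinuity, the right-hand sides of the regularized rows are those of the
original kernels. -/
theorem rowRhs_regularizedRows (i : Fin n) (c : RowIndex n m) {z : ℝ × ℝ} (hz : z ∈ Tri)
    (hJ : (∀ k l, ¬ P.Jump k l z) ∨ ∃ j, c = .inr (.inr j)) :
    P.rowRhs (rowsK (P.regularizedRows U K L Phi)) (rowsL (P.regularizedRows U K L Phi))
      (rowsPhi (P.regularizedRows U K L Phi)) i c z = P.rowRhs K L Phi i c z := by
  refine rowRhs_congr (fun z hz i j h => regularizedRows_K (L := L) (Phi := Phi) hz h) (fun z hz => ?_)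
    (fun x hx => ?_) i c hz hJ
  · ext i j
    exact regularizedRows_L (P := P) (U := U) (K := K) (Phi := Phi) hz
  · ext i j
    exact regularizedRows_Phi (P := P) (U := U) (K := K) (L := L) (z := (x, 0)) ⟨hx.1, hx.2, rfl⟩

/-- The entrance value of a characteristic, for the rows of a solution. -/
theorem regularizedRows_entry (hs : P.IsBoundedKernelSolution Phi0 K L Phi) (i : Fin n)
    (c : RowIndex n m) {z : ℝ × ℝ} (hz : z ∈ rowDomain c)
    (hJ : ∀ j, c = .inl j → ¬ P.Jump i j z) :
    P.regularizedRows U K L Phi i c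
        (z.1 + P.sm i * -P.rowTime i c z, z.2 + P.rowSpeed c * -P.rowTime i c z) =
      P.rowData Phi0 i c
        (z.1 + P.sm i * -P.rowTime i c z, z.2 + P.rowSpeed c * -P.rowTime i c z) +
      ∑ c', P.rowBottom c c'
          (z.1 + P.sm i * -P.rowTime i c z, z.2 + P.rowSpeed c * -P.rowTime i c z) *
        P.regularizedRows U K L Phi i c'
          (z.1 + P.sm i * -P.rowTime i c z, z.2 + P.rowSpeed c * -P.rowTime i c z) := by
  have hτ := P.rowTime_nonneg i c hz
  have hmem := P.row_segment_mem i c hz (r := -P.rowTime i c z) ⟨le_rfl, by linarith⟩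
  obtain ⟨x, y⟩ := z
  have hi := P.sm_pos i
  rcases c with j | j | j
  · have hj := P.sm_pos j
    have hJ' := hJ j rfl
    have hz' : (x, y) ∈ Tri := hz
    by_cases h : P.sm i * y ≤ P.sm j * x
    · rw [P.rowTime_of_le (z := (x, y)) h] at hmem ⊢
      have ey : y + P.rowSpeed (.inl j : RowIndex n m) * -(y / P.sm j) = 0 := by
        simp only [rowSpeed]; field_simp; ring
      simp only [ey] at hmem ⊢
      set ξ := x + P.sm i * -(y / P.sm j) with hξ
      have hξm : ξ ∈ Icc (0 : ℝ) 1 := ⟨hmem.2.1, hmem.2.2⟩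
      -- Strictly below the jump line the characteristic enters to the right of the corner, where
      -- the bottom condition is required even for `s_j < s_i`.
      have hlt : P.sm j < P.sm i → 0 < ξ := by
        intro h'
        have h1 : P.sm i * y < P.sm j * x := lt_of_le_of_ne h fun e => hJ' ⟨h', e⟩
        have h2 : P.sm j * ξ = P.sm j * x - P.sm i * y := by
          rw [hξ]; field_simp; ring
        exact pos_of_mul_pos_right (by rw [h2]; linarith) hj.le
      have hnJ : ¬ P.Jump i j (ξ, 0) := by
        rintro ⟨h1, h2⟩
        have := mul_pos hj (hlt h1)
        simp only [mul_zero] at h2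
        linarith
      have hb := hs.bottom i j ξ hξm (by
        rcases lt_or_ge (P.sm j) (P.sm i) with h' | h'
        · exact Or.inl (hlt h')
        · exact Or.inr h')
      rw [bottom_iff P (P.regularizedRows U K L Phi i) (K ξ 0) (L ξ 0) (Phi ξ) i j ξ
        (fun k => regularizedRows_L (z := (ξ, 0)) hmem)
        (fun k => regularizedRows_Phi (z := (ξ, 0)) ⟨hξm.1, hξm.2, rfl⟩)] at hb
      rw [regularizedRows_K hmem hnJ, hb]
      simp [rowData]
    · rw [P.rowTime_of_not_le (z := (x, y)) h] at hmem ⊢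
      push Not at h
      have hlt := P.lt_of_mem_above (z := (x, y)) hz' h
      have hd : 0 < P.sm i - P.sm j := sub_pos.2 hlt
      have ey : y + P.rowSpeed (.inl j : RowIndex n m) * -((x - y) / (P.sm i - P.sm j)) =
          x + P.sm i * -((x - y) / (P.sm i - P.sm j)) := by
        simp only [rowSpeed]; field_simp; ring
      simp only [ey] at hmem ⊢
      set ξ := x + P.sm i * -((x - y) / (P.sm i - P.sm j)) with hξ
      -- Above the jump line the entrance point is on the diagonal, away from the corner, so the
      -- condition on the half-open interval applies.
      have hξ0 : 0 < ξ := by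
        have h2 : (P.sm i - P.sm j) * ξ = P.sm i * y - P.sm j * x := by
          rw [hξ]; field_simp; ring
        exact pos_of_mul_pos_right (by rw [h2]; linarith) hd.le
      have hnJ : ¬ P.Jump i j (ξ, ξ) := by
        rintro ⟨h1, h2⟩
        have := mul_pos hd hξ0
        simp only at h2
        linarith
      have hb := congrFun (congrFun (hs.diagK ξ ⟨hξ0, hmem.2.2⟩) i) j
      have hij : ¬ j < i := fun h' => absurd hlt (not_lt.2 (P.sm_anti h'.le))
      rw [Sm_mul_sub_mul_Sm, Matrix.add_apply, Matrix.neg_apply, Omega, Matrix.of_apply,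
        if_neg hij, add_zero] at hb
      have h2 : ∀ c', P.rowBottom (.inl j) c' (ξ, ξ) = 0 := by
        rintro (k | k | k) <;> simp [rowBottom, hξ0.ne']
      rw [regularizedRows_K hmem hnJ]
      simp only [rowData, h2, zero_mul, Finset.sum_const_zero, add_zero, if_neg hξ0.ne']
      field_simp
      linarith
  · have hj := P.sp_pos j
    have hd : 0 < P.sm i + P.sp j := add_pos hi hj
    have ey : y + P.rowSpeed (.inr (.inl j) : RowIndex n m) *
        -P.rowTime i (.inr (.inl j)) (x, y) =
        x + P.sm i * -P.rowTime i (.inr (.inl j)) (x, y) := by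
      simp only [rowSpeed, rowTime]; field_simp; ring
    simp only [ey] at hmem ⊢
    set ξ := x + P.sm i * -P.rowTime i (.inr (.inl j)) (x, y) with hξ
    have hξm : ξ ∈ Icc (0 : ℝ) 1 := ⟨hmem.1, hmem.2.2⟩
    have hb := congrFun (congrFun (hs.diagL ξ hξm) i) j
    rw [Sm_mul_add_mul_Sp, Matrix.neg_apply] at hb
    rw [regularizedRows_L hmem]
    simp only [rowData, rowBottom, zero_mul, Finset.sum_const_zero, add_zero]
    field_simp
    linarith
  · have hy : y = 0 := hz.2.2
    subst hy
    have ex : x + P.sm i * -P.rowTime i (.inr (.inr j)) (x, 0) = 0 := by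
      simp only [rowTime]; field_simp; ring
    simp only [ex] at hmem ⊢
    rw [regularizedRows_Phi hmem]
    simp [rowData, rowBottom, hs.init]

/-- The equations are stated forward from a starting point, while the operator integrates backward
from the end point. A shift of time by `τ` reconciles them. -/
theorem sub_eq_integral_along {f R : ℝ × ℝ → ℝ} {a e x y τ : ℝ} (hτ : 0 ≤ τ)
    (hac : AbsolutelyContinuousOnInterval (fun r => f (x + a * -τ + a * r, y + e * -τ + e * r)) 0 τ)
    (hd : ∀ᵐ s : ℝ, s ∈ Ioo 0 τ →
      HasDerivAt (fun r => f (x + a * -τ + a * r, y + e * -τ + e * r))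
        (R (x + a * -τ + a * s, y + e * -τ + e * s)) s) :
    f (x, y) - f (x + a * -τ, y + e * -τ) = ∫ r in (-τ)..0, R (x + a * r, y + e * r) := by
  have h1 := hac.sub_eq_integral_of_ae_hasDerivAt hτ hd
  have h2 := intervalIntegral.integral_comp_add_right (a := 0) (b := τ)
    (fun r => R (x + a * r, y + e * r)) (-τ)
  rw [zero_add, add_neg_cancel] at h2
  rw [← h2]
  convert h1 using 1
  · congr 1 <;> congr 2 <;> ring
  · congr 1
    funext s
    congr 2 <;> ring

/-- The integrated kernel equations, for the rows of a solution. -/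
theorem regularizedRows_sub_entry (hs : P.IsBoundedKernelSolution Phi0 K L Phi) (i : Fin n)
    (c : RowIndex n m) {z : ℝ × ℝ} (hz : z ∈ rowDomain c)
    (hJ : ∀ j, c = .inl j → ¬ P.Jump i j z) :
    P.regularizedRows U K L Phi i c z - P.regularizedRows U K L Phi i c
        (z.1 + P.sm i * -P.rowTime i c z, z.2 + P.rowSpeed c * -P.rowTime i c z) =
      ∫ r in (-P.rowTime i c z)..0,
        P.rowRhs K L Phi i c (z.1 + P.sm i * r, z.2 + P.rowSpeed c * r) := by
  have hτ := P.rowTime_nonneg i c hz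
  have hmem := P.row_segment_mem i c hz (r := -P.rowTime i c z) ⟨le_rfl, by linarith⟩
  obtain ⟨x, y⟩ := z
  have hi := P.sm_pos i
  rcases c with j | j | j
  · have hj := P.sm_pos j
    have hJ' := hJ j rfl
    have hz' : (x, y) ∈ Tri := hz
    set τ := P.rowTime i (.inl j) (x, y) with hτdef
    simp only [rowSpeed] at hmem ⊢
    have hnJ : ¬ P.Jump i j (x + P.sm i * -τ, y + P.sm j * -τ) := by
      rintro ⟨h1, h2⟩
      refine hJ' ⟨h1, ?_⟩
      simp only at h2 ⊢
      linear_combination h2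
    -- The excluded case would place the entrance point at the corner with `s_j < s_i`; the corner
    -- lies on the jump line, which this characteristic avoids.
    have hpos : 0 < x + P.sm i * -τ ∨ P.sm i ≤ P.sm j := by
      by_contra! hcon
      have e1 : x + P.sm i * -τ = 0 := le_antisymm hcon.1 (hmem.1.trans hmem.2.1)
      have e2 : y + P.sm j * -τ = 0 := le_antisymm (hmem.2.1.trans hcon.1) hmem.1
      exact hnJ ⟨hcon.2, by simp only [e1, e2, mul_zero]⟩
    have hend : (x + P.sm i * -τ + P.sm i * τ, y + P.sm j * -τ + P.sm j * τ) ∈ Tri := by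
      convert hz' using 2 <;> ring
    obtain ⟨hac, hd⟩ := hs.eqK i j _ _ τ hτ hmem hend hpos
    rw [regularizedRows_K hz' hJ', regularizedRows_K hmem hnJ]
    exact sub_eq_integral_along (f := fun z => K z.1 z.2 i j)
      (R := P.rowRhs K L Phi i (.inl j)) hτ hac hd
  · have hz' : (x, y) ∈ Tri := hz
    set τ := P.rowTime i (.inr (.inl j)) (x, y) with hτdef
    simp only [rowSpeed] at hmem ⊢
    have hend : (x + P.sm i * -τ + P.sm i * τ, y + -P.sp j * -τ - P.sp j * τ) ∈ Tri := by
      convert hz' using 2 <;> ring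
    obtain ⟨hac, hd⟩ := hs.eqL i j _ _ τ hτ hmem hend
    simp only [sub_eq_add_neg (_ + _) (P.sp j * _), ← neg_mul (P.sp j)] at hac hd
    rw [regularizedRows_L hz', regularizedRows_L hmem]
    exact sub_eq_integral_along (f := fun z => L z.1 z.2 i j)
      (R := P.rowRhs K L Phi i (.inr (.inl j))) hτ hac hd
  · have hz' : (x, y) ∈ rowDomain (.inr (.inr j) : RowIndex n m) := hz
    obtain ⟨hx0, hx1, hy⟩ := hz
    simp only at hx0 hx1 hy
    subst hy
    rw [regularizedRows_Phi hz', regularizedRows_Phi hmem]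
    simp only [rowTime, rowRhs]
    have ex : x + P.sm i * -(x / P.sm i) = 0 := by field_simp; ring
    obtain ⟨hac, hd⟩ := hs.eqPhi i j
    have hac' := hac.mono (c := 0) (d := x) (by
      rw [uIcc_of_le hx0, uIcc_of_le zero_le_one]
      exact Icc_subset_Icc le_rfl hx1)
    have hd' : ∀ᵐ s : ℝ, s ∈ Ioo 0 x →
        HasDerivAt (fun r => Phi r i j) ((P.sm i)⁻¹ * P.rhsPhi K L Phi s i j) s := by
      filter_upwards [hd] with s hs hsx
      obtain ⟨d, h1, h2⟩ := hs ⟨hsx.1, hsx.2.trans_le hx1⟩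
      rwa [← h2, inv_mul_cancel_left₀ hi.ne']
    have h1 := hac'.sub_eq_integral_of_ae_hasDerivAt hx0 hd'
    -- The substitution `s = x + s_i r` passes from abscissa to characteristic time and absorbs the
    -- factor `1 / s_i`.
    rw [ex, h1, intervalIntegral.integral_const_mul,
      intervalIntegral.integral_comp_add_mul (fun s => P.rhsPhi K L Phi s i j) hi.ne', ex,
      mul_zero, add_zero, smul_eq_mul]

theorem op_regularizedRows (hU : ∀ k, U k ∈ boundedFamilies rowDomain)
    (hs : P.IsBoundedKernelSolution Phi0 K L Phi) (i : Fin n)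
    (c : RowIndex n m) {z : ℝ × ℝ} (hz : z ∈ rowDomain c)
    (hJ : ∀ j, c = .inl j → ¬ P.Jump i j z) :
    (P.rowSystemOf Phi0 (P.regularizedRows U K L Phi) (regularizedRows_mem hU hs) i).op
      (P.regularizedRows U K L Phi i) c z = P.regularizedRows U K L Phi i c z := by
  rw [CharSystem.op_of_mem _ _ hz]
  have h1 := regularizedRows_entry (U := U) hs i c hz hJ
  have h2 := regularizedRows_sub_entry (U := U) hs i c hz hJ
  have h3 : ∫ r in (-P.rowTime i c z)..0, linearRhs (P.rowSource (P.regularizedRows U K L Phi) i)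
      P.rowCoupling (P.rowTrace (P.regularizedRows U K L Phi) i) P.rowMemory
      (P.regularizedRows U K L Phi i) c (z.1 + P.sm i * r, z.2 + P.rowSpeed c * r) =
      ∫ r in (-P.rowTime i c z)..0,
        P.rowRhs K L Phi i c (z.1 + P.sm i * r, z.2 + P.rowSpeed c * r) := by
    have hmem : ∀ r ∈ uIoc (-P.rowTime i c z) 0,
        (z.1 + P.sm i * r, z.2 + P.rowSpeed c * r) ∈ rowDomain c := by
      intro r hr
      have hτ := P.rowTime_nonneg i c hz
      rw [uIoc_of_le (by linarith)] at hr
      exact P.row_segment_mem i c hz ⟨hr.1.le, hr.2⟩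
    have hbm := fun k => triBounded_of_mem (regularizedRows_mem hU hs k)
    -- The right-hand side for `Φ` sees `K` only through `Ω` and vertical integrals, so it agrees at
    -- every point. For `K` and `L` pointwise values of `K` enter, and agreement holds only almost
    -- everywhere on the characteristic.
    by_cases hc : ∃ j, c = .inr (.inr j)
    · refine intervalIntegral.integral_congr_ae (Filter.Eventually.of_forall fun r hr => ?_)
      rw [← P.rowRhs_eq_linearRhs hbm i c (hmem r hr)]
      exact rowRhs_regularizedRows i c (rowDomain_subset c (hmem r hr)) (Or.inr hc)
    · push Not at hc
      refine intervalIntegral.integral_congr_ae ?_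
      filter_upwards [P.ae_not_jump_flow (i := i) hc hJ] with r hr hr'
      rw [← P.rowRhs_eq_linearRhs hbm i c (hmem r hr')]
      exact rowRhs_regularizedRows i c (rowDomain_subset c (hmem r hr')) (Or.inl hr)
  have h4 : P.regularizedRows U K L Phi i c z = P.regularizedRows U K L Phi i c
        (z.1 + P.sm i * -P.rowTime i c z, z.2 + P.rowSpeed c * -P.rowTime i c z) +
      ∫ r in (-P.rowTime i c z)..0,
        P.rowRhs K L Phi i c (z.1 + P.sm i * r, z.2 + P.rowSpeed c * r) := by
    rw [← h2]; ring
  rw [h4, h1, ← h3]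
  rfl

/-- The regularized rows of any solution are those of the constructed solution. -/
theorem regularizedRows_eq (hU : ∀ k, U k ∈ boundedFamilies rowDomain)
    (h : ∀ i, (P.rowSystemOf Phi0 U hU i).op (U i) = U i)
    (hs : P.IsBoundedKernelSolution Phi0 K L Phi) (i : Fin n) :
    P.regularizedRows U K L Phi i = U i := by
  induction i using WellFoundedLT.induction with
  | ind i ih =>
    have hV := regularizedRows_mem hU hs
    -- By the induction hypothesis the preceding rows coincide with those of `U`, so both candidates
    -- for row `i` are compared in one and the same linear system.
    have e := P.rowSystemOf_congr Phi0 hV hU ih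
    refine (P.rowSystemOf Phi0 U hU i).eq_of_op_eq (hU i) (hV i) (h i) fun c z hz => ?_
    by_cases hJ : ∀ j, c = .inl j → ¬ P.Jump i j z
    · left
      rw [← e]
      exact op_regularizedRows hU hs i c hz hJ
    · right
      push Not at hJ
      obtain ⟨j, rfl, hJ⟩ := hJ
      simp only [regularizedRows, if_pos hJ]

end Uniqueness

end Plant

/-! ### Conclusion: existence, exponential bound and uniqueness. -/

theorem theorem2 {n m : ℕ} (P : Plant n m) (Phi0 : Matrix (Fin n) (Fin m) ℝ) :
    ∃ (K : ℝ → ℝ → Matrix (Fin n) (Fin n) ℝ) (L : ℝ → ℝ → Matrix (Fin n) (Fin m) ℝ)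
      (Phi : ℝ → Matrix (Fin n) (Fin m) ℝ),
      -- existence
      P.IsBoundedKernelSolution Phi0 K L Phi ∧
      -- exponential bound
      (∃ N M : ℝ, 0 < N ∧ 0 < M ∧
        (∀ x y : ℝ, (x, y) ∈ Tri → ∀ i j, |K x y i j| ≤ N * Real.exp (M * x)) ∧
        (∀ x y : ℝ, (x, y) ∈ Tri → ∀ i j, |L x y i j| ≤ N * Real.exp (M * x)) ∧
        (∀ x ∈ Set.Icc (0 : ℝ) 1, ∀ i j, |Phi x i j| ≤ N * Real.exp (M * x))) ∧
      -- uniqueness; if `sm j < sm i`, the values of `K_{ij}` on its line of discontinuity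
      -- `sm i * y = sm j * x` are not determined and are left out
      (∀ (K' : ℝ → ℝ → Matrix (Fin n) (Fin n) ℝ) (L' : ℝ → ℝ → Matrix (Fin n) (Fin m) ℝ)
        (Phi' : ℝ → Matrix (Fin n) (Fin m) ℝ),
        P.IsBoundedKernelSolution Phi0 K' L' Phi' →
        (∀ x y : ℝ, (x, y) ∈ Tri → ∀ i j, ¬ (P.sm j < P.sm i ∧ P.sm i * y = P.sm j * x) →
          K' x y i j = K x y i j) ∧
        (∀ x y : ℝ, (x, y) ∈ Tri → L' x y = L x y) ∧
        (∀ x ∈ Set.Icc (0 : ℝ) 1, Phi' x = Phi x)) := by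
  obtain ⟨U, hU, h⟩ := P.exists_rows Phi0
  have hs := Plant.isBoundedKernelSolution_rows h
  refine ⟨Plant.rowsK U, Plant.rowsL U, Plant.rowsPhi U, hs, ?_, fun K' L' Phi' hs' => ?_⟩
  · obtain ⟨bK, hK⟩ := hs.bounded_K
    obtain ⟨bL, hL⟩ := hs.bounded_L
    obtain ⟨bP, hP⟩ := hs.bounded_Phi
    have hN : 0 < |bK| + |bL| + |bP| + 1 := by positivity
    have e1 := abs_nonneg bK
    have e2 := abs_nonneg bL
    have e3 := abs_nonneg bP
    -- Since `exp x ≥ 1` for `x ≥ 0`, any uniform bound serves with `M = 1`; the summand `1` makes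
    -- `N` positive.
    have key : ∀ x a : ℝ, 0 ≤ x → a ≤ |bK| + |bL| + |bP| + 1 →
        a ≤ (|bK| + |bL| + |bP| + 1) * Real.exp (1 * x) := fun x a hx ha =>
      ha.trans (le_mul_of_one_le_right hN.le (Real.one_le_exp (by linarith)))
    refine ⟨|bK| + |bL| + |bP| + 1, 1, hN, one_pos, fun x y hxy i j => ?_, fun x y hxy i j => ?_,
      fun x hx i j => ?_⟩
    · exact key x _ (hxy.1.trans hxy.2.1) (by linarith [hK (x, y) hxy i j, le_abs_self bK])
    · exact key x _ (hxy.1.trans hxy.2.1) (by linarith [hL (x, y) hxy i j, le_abs_self bL])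
    · exact key x _ hx.1 (by linarith [hP x hx i j, le_abs_self bP])
  · have hV := Plant.regularizedRows_eq hU h hs'
    refine ⟨fun x y hxy i j hJ => ?_, fun x y hxy => ?_, fun x hx => ?_⟩
    · rw [← Plant.regularizedRows_K (U := U) (K := K') (L := L') (Phi := Phi') (z := (x, y)) hxy hJ, hV]
      rfl
    · ext i j
      rw [← Plant.regularizedRows_L (P := P) (U := U) (K := K') (L := L') (Phi := Phi') (z := (x, y)) hxy, hV]
      rfl
    · ext i j
      rw [← Plant.regularizedRows_Phi (P := P) (U := U) (K := K') (L := L') (Phi := Phi') (z := (x, 0))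
        ⟨hx.1, hx.2, rfl⟩, hV]
      rfl
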